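/- **Setting.** Let $h\neq0$ be real and let $u$ be a field depending on $n$ (discrete) and $\bar x$ (continuous). Put $\partial=\partial_{\bar x}$, $Ef(n)=f(n+1)$, $\Delta=E-1$. Let $\mathcal F$ be the algebra of functions $f(u)$ with $f(0)=0$ generated from $u$ by sums, products, multiplication by real polynomials in $\bar x,n$, and the operators $\partial,\partial^{-1},E^{\pm1},\Delta^{-1}$, modulo the rules of calculus (commutative algebra laws; $\partial$ is a derivation with $\partial\bar x=1$, $\partial n=0$; $E$ is an automorphism commuting with $\partial$, with $E\bar x=\bar x$, $En=n+1$; $\partial^{-1},E^{-1},\Delta^{-1}$ are two-sided inverses of $\partial,E,\Delta$ on $\mathcal F$). Functionals are real linear combinations of expressions $\sum_n\int fg\,d\bar x$ ($f,g\in\mathcal F$), bilinear in $(f,g)$, modulo the rules $\sum\!\int fg=\sum\!\int gf$, $\sum\!\int (fg)k=\sum\!\int f(gk)$, $\sum\!\int (pf)g=\sum\!\int f(pg)$ for polynomials $p(\bar x,n)$, $\sum\!\int(\partial f)g=-\sum\!\int f\,\partial g$, $\sum\!\int (Ef)(Eg)=\sum\!\int fg$. Put $(f,g)=\frac{h^2}{2}\sum_n\int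 fg\,d\bar x$. Let $'[g]$ be the Gâteaux derivative in the direction $g$; $f=\delta H/\delta u$ means $H'[g]=(f,g)$ for all $g\in\mathcal F$; and $\{H,J\}=(\delta H/\delta u,\ \partial\,\delta J/\delta u)$. **Flows.** Let $\bar L=h^{-1}\Delta+u+h\bar u_1\Delta^{-1}+h^2\bar u_2\Delta^{-2}+\cdots$, where $\bar u_j\in\mathcal F$ ($j\ge1$) are determined by $\bar L_{\bar x}=[\bar A_1,\bar L]$, and $\bar A_m=(\bar L^m)_+$ is the part with nonnegative powers of $\Delta$. For $m\ge1$ put $\bar K_m=\bar A_{m,\bar x}-[\bar A_1,\bar A_m]$. Let $\bar B_m$ be the difference operator of order at most $m$ with $\bar B_m|_{u=0}=h^{-(m-1)}\bar x\Delta^m+h^{-(m-1)}(\bar x+hn)\Delta^{m-1}$ and $\bar\sigma_m\in\mathcal F$ the function such that $\bar L'[\bar\sigma_m]=[\bar B_m,\bar L]+h\bar L^m+\bar L^{m-1}$ and $\bar\sigma_m=\bar B_{m,\bar x}-[\bar A_1,\bar B_m]$. Put $\bar\gamma_m=\partial^{-1}\bar K_m$, $\bar\omega_m=\partial^{-1}\bar\sigma_m$,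 and $$\bar H_0=0,\quad \bar H_1=\tfrac12(u,u),\quad \bar H_s=\tfrac1h\Bigl(\tfrac1{s-1}(\bar\gamma_{s-1},\bar\sigma_2)-\bar H_{s-1}\Bigr)\ (s>1),$$ $$\bar J_0=0,\quad \bar J_1=\tfrac h2(\bar xu,u),\quad \bar J_3=\int_0^1(\bar\omega_3(\lambda u),u)\,d\lambda,\quad \bar J_s=\tfrac1h\Bigl(\tfrac1{s-3}(\bar\omega_{s-1},\bar\sigma_2)-\bar J_{s-1}\Bigr)\ (s>1,\ s\ne3),$$ $$\bar I^s_0=0,\qquad \bar I^s_r=s\,\bar t_s\,(h\bar H_{s+r-1}+\bar H_{s+r-2})+\bar J_r\quad(s,r\ge1).$$ **Theorem.** For all $m\ge 1$ the operator $\bar A_{m,\bar x}-[\bar A_1,\bar A_m]$ is multiplication by a function in $\mathcal F$ (so that $\bar K_m$ makes sense), the pair $(\bar B_m,\bar\sigma_m)$ exists and is unique, and $\delta\bar H_m/\delta u=\bar\gamma_m$, $\delta\bar J_m/\delta u=\bar\omega_m$. For every $s\ge1$ the equation $u_{\bar t_s}=\bar K_s$ has the two sets of conserved quantities $\{\bar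 H_l\}_{l\ge1}$ and $\{\bar I^s_r\}_{r\ge1}$, i.e. $\partial I/\partial\bar t_s+I'[\bar K_s]=0$, where $\partial/\partial\bar t_s$ acts on the explicit $\bar t_s$ only. For all $l,r,s\ge1$ (and all values of $\bar t_s$) $$\{\bar H_l,\bar H_r\}=0,\quad \{\bar H_l,\bar J_r\}=l(h\bar H_{l+r-1}+\bar H_{l+r-2}),\quad \{\bar J_l,\bar J_r\}=(l-r)(h\bar J_{l+r-1}+\bar J_{l+r-2}),$$ $$\{\bar H_l,\bar I^s_r\}=l(h\bar H_{l+r-1}+\bar H_{l+r-2}),\qquad \{\bar I^s_l,\bar I^s_r\}=(l-r)(h\bar I^s_{l+r-1}+\bar I^s_{l+r-2}).$$ The real linear span of all $\bar H_l,\bar J_r$ ($l,r\ge1$), and for each $s\ge1$ the real linear span of all $\bar H_l,\bar I^s_r$ ($l,r\ge1$; as functions of $\bar t_s$), are closed under $\{\cdot,\cdot\}$ and are Lie algebras with this bracket. -/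

import Mathlib

open scoped TensorProduct

namespace DDKP

noncomputable section

/-! ### Explicit dependence on the independent variables -/

/-- Polynomials in the independent variables: `X 0` is the continuous variable `x`,
`X 1` is the discrete variable `n`. -/
abbrev P : Type := MvPolynomial (Fin 2) ℝ

/-- The variable `x` as an element of `P`. -/
def varX : P := MvPolynomial.X 0

/-- The variable `n` as an element of `P`. -/
def varN : P := MvPolynomial.X 1

/-- `∂/∂x` on polynomials in `x, n`. -/
def dP (p : P) : P := MvPolynomial.pderiv 0 p

/-- The shift `n ↦ n + 1` on polynomials in `x, n`. -/
def shP : P ≃ₐ[ℝ] P :=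
  AlgEquiv.ofAlgHom
    (MvPolynomial.aeval ![MvPolynomial.X 0, MvPolynomial.X 1 + 1])
    (MvPolynomial.aeval ![MvPolynomial.X 0, MvPolynomial.X 1 - 1])
    (by ext i; fin_cases i <;> simp)
    (by ext i; fin_cases i <;> simp)

/-! ### The algebra of functions `f(u)` with `f(0) = 0` -/

/-- Expressions in the field `u` built with sums, products, multiplication by polynomials in
`x, n`, the operators `∂`, `∂⁻¹`, the shifts `E`, `E⁻¹` and `Δ⁻¹ = (E - 1)⁻¹`. -/
inductive Expr : Type
  | u : Expr
  | zero : Expr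
  | add : Expr → Expr → Expr
  | smul : P → Expr → Expr
  | mul : Expr → Expr → Expr
  | dx : Expr → Expr
  | dxInv : Expr → Expr
  | sh : Expr → Expr
  | shInv : Expr → Expr
  | delInv : Expr → Expr

/-- Two expressions denote the same function of `u` if this follows from: the laws of a commutative
algebra over the polynomials in `x, n`; `∂` is an additive derivation with `∂ x = 1`, `∂ n = 0`;
`E` is a ring automorphism with `E x = x`, `E n = n + 1`, commuting with `∂`; and
`∂ ∂⁻¹ = ∂⁻¹ ∂ = 1`, `E E⁻¹ = E⁻¹ E = 1`, `Δ Δ⁻¹ = Δ⁻¹ Δ = 1` for `Δ = E - 1`. -/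
inductive Rel : Expr → Expr → Prop
  | refl (a) : Rel a a
  | symm {a b} : Rel a b → Rel b a
  | trans {a b c} : Rel a b → Rel b c → Rel a c
  | add_congr {a a' b b'} : Rel a a' → Rel b b' → Rel (.add a b) (.add a' b')
  | smul_congr (p) {a a'} : Rel a a' → Rel (.smul p a) (.smul p a')
  | mul_congr {a a' b b'} : Rel a a' → Rel b b' → Rel (.mul a b) (.mul a' b')
  | dx_congr {a a'} : Rel a a' → Rel (.dx a) (.dx a')
  | dxInv_congr {a a'} : Rel a a' → Rel (.dxInv a) (.dxInv a')
  | sh_congr {a a'} : Rel a a' → Rel (.sh a) (.sh a')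
  | shInv_congr {a a'} : Rel a a' → Rel (.shInv a) (.shInv a')
  | delInv_congr {a a'} : Rel a a' → Rel (.delInv a) (.delInv a')
  | add_comm (a b) : Rel (.add a b) (.add b a)
  | add_assoc (a b c) : Rel (.add (.add a b) c) (.add a (.add b c))
  | zero_add (a) : Rel (.add .zero a) a
  | neg_add (a) : Rel (.add (.smul (-1) a) a) .zero
  | smul_add (p a b) : Rel (.smul p (.add a b)) (.add (.smul p a) (.smul p b))
  | add_smul (p q a) : Rel (.smul (p + q) a) (.add (.smul p a) (.smul q a))
  | mul_smul (p q a) : Rel (.smul (p * q) a) (.smul p (.smul q a))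
  | one_smul (a) : Rel (.smul 1 a) a
  | mul_comm (a b) : Rel (.mul a b) (.mul b a)
  | mul_assoc (a b c) : Rel (.mul (.mul a b) c) (.mul a (.mul b c))
  | mul_add (a b c) : Rel (.mul a (.add b c)) (.add (.mul a b) (.mul a c))
  | smul_mul (p a b) : Rel (.mul (.smul p a) b) (.smul p (.mul a b))
  | dx_add (a b) : Rel (.dx (.add a b)) (.add (.dx a) (.dx b))
  | dx_smul (p a) : Rel (.dx (.smul p a)) (.add (.smul (dP p) a) (.smul p (.dx a)))
  | dx_mul (a b) : Rel (.dx (.mul a b)) (.add (.mul (.dx a) b) (.mul a (.dx b)))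
  | sh_add (a b) : Rel (.sh (.add a b)) (.add (.sh a) (.sh b))
  | sh_smul (p a) : Rel (.sh (.smul p a)) (.smul (shP p) (.sh a))
  | sh_mul (a b) : Rel (.sh (.mul a b)) (.mul (.sh a) (.sh b))
  | sh_dx (a) : Rel (.sh (.dx a)) (.dx (.sh a))
  | dx_dxInv (a) : Rel (.dx (.dxInv a)) a
  | dxInv_dx (a) : Rel (.dxInv (.dx a)) a
  | sh_shInv (a) : Rel (.sh (.shInv a)) a
  | shInv_sh (a) : Rel (.shInv (.sh a)) a
  | del_delInv (a) : Rel (.add (.sh (.delInv a)) (.smul (-1) (.delInv a))) a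
  | delInv_del (a) : Rel (.delInv (.add (.sh a) (.smul (-1) a))) a

/-- The setoid of expressions modulo the rules of calculus. -/
def exprSetoid : Setoid Expr := ⟨Rel, Rel.refl, Rel.symm, Rel.trans⟩

/-- The algebra of functions `f = f(u)` with `f|_{u=0} = 0`. -/
def F : Type := Quotient exprSetoid

namespace F

/-- The class of an expression. -/
def mk (e : Expr) : F := Quotient.mk exprSetoid e

theorem mk_eq {a b : Expr} (r : Rel a b) : mk a = mk b := Quotient.sound (s := exprSetoid) r

theorem ind {C : F → Prop} (c : ∀ e, C (mk e)) (f : F) : C f := Quotient.ind c f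

/-- The field `u`. -/
def u : F := mk .u

instance : Zero F := ⟨mk .zero⟩
instance : Add F := ⟨Quotient.map₂ Expr.add fun _ _ r _ _ s => Rel.add_congr r s⟩
instance : Mul F := ⟨Quotient.map₂ Expr.mul fun _ _ r _ _ s => Rel.mul_congr r s⟩
instance : SMul P F := ⟨fun p => Quotient.map (Expr.smul p) fun _ _ r => Rel.smul_congr p r⟩
instance : Neg F := ⟨fun f => (-1 : P) • f⟩

/-- `∂ = ∂/∂x`. -/
def dx : F → F := Quotient.map Expr.dx fun _ _ r => Rel.dx_congr r

/-- `∂⁻¹`. -/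
def dxInv : F → F := Quotient.map Expr.dxInv fun _ _ r => Rel.dxInv_congr r

/-- The shift `E`. -/
def sh : F → F := Quotient.map Expr.sh fun _ _ r => Rel.sh_congr r

/-- The inverse shift `E⁻¹`. -/
def shInv : F → F := Quotient.map Expr.shInv fun _ _ r => Rel.shInv_congr r

/-- `Δ⁻¹ = (E - 1)⁻¹`. -/
def delInv : F → F := Quotient.map Expr.delInv fun _ _ r => Rel.delInv_congr r

protected theorem add_comm' (a b : F) : a + b = b + a :=
  Quotient.inductionOn₂ a b fun _ _ => mk_eq (.add_comm _ _)
protected theorem add_assoc' (a b c : F) : a + b + c = a + (b + c) :=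
  Quotient.inductionOn₃ a b c fun _ _ _ => mk_eq (.add_assoc _ _ _)
protected theorem zero_add' (a : F) : 0 + a = a :=
  Quotient.inductionOn a fun _ => mk_eq (.zero_add _)

instance : AddCommGroup F where
  add_assoc := F.add_assoc'
  zero_add := F.zero_add'
  add_zero a := by rw [F.add_comm', F.zero_add']
  add_comm := F.add_comm'
  nsmul := nsmulRec
  zsmul := zsmulRec
  neg_add_cancel a := Quotient.inductionOn a fun _ => mk_eq (.neg_add _)

instance : NonUnitalCommRing F where
  left_distrib a b c := Quotient.inductionOn₃ a b c fun _ _ _ => mk_eq (.mul_add _ _ _)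
  right_distrib a b c := Quotient.inductionOn₃ a b c fun _ _ _ =>
    mk_eq ((Rel.mul_comm _ _).trans ((Rel.mul_add _ _ _).trans
      (Rel.add_congr (Rel.mul_comm _ _) (Rel.mul_comm _ _))))
  mul_comm a b := Quotient.inductionOn₂ a b fun _ _ => mk_eq (.mul_comm _ _)
  mul_assoc a b c := Quotient.inductionOn₃ a b c fun _ _ _ => mk_eq (.mul_assoc _ _ _)
  zero_mul a := by
    have key : ∀ b : F, b * a = b * a + 0 * a := fun b =>
      calc b * a = (b + 0) * a := by rw [add_zero]
        _ = b * a + 0 * a := Quotient.inductionOn₃ b (0 : F) a fun _ _ _ =>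
          mk_eq ((Rel.mul_comm _ _).trans ((Rel.mul_add _ _ _).trans
            (Rel.add_congr (Rel.mul_comm _ _) (Rel.mul_comm _ _))))
    simpa using key 0
  mul_zero a := by
    have key : a * 0 = a * 0 + a * 0 :=
      calc a * 0 = a * (0 + 0) := by rw [add_zero]
        _ = a * 0 + a * 0 := Quotient.inductionOn₂ a (0 : F) fun _ _ => mk_eq (.mul_add _ _ _)
    simpa using key

protected theorem smul_add' (p : P) (a b : F) : p • (a + b) = p • a + p • b :=
  Quotient.inductionOn₂ a b fun _ _ => mk_eq (.smul_add _ _ _)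
protected theorem add_smul' (p q : P) (a : F) : (p + q) • a = p • a + q • a :=
  Quotient.inductionOn a fun _ => mk_eq (.add_smul _ _ _)

instance : Module P F where
  one_smul a := Quotient.inductionOn a fun _ => mk_eq (.one_smul _)
  mul_smul p q a := Quotient.inductionOn a fun _ => mk_eq (.mul_smul _ _ _)
  smul_add := F.smul_add'
  add_smul := F.add_smul'
  smul_zero q := by simpa using F.smul_add' q 0 0
  zero_smul a := by simpa using F.add_smul' 0 0 a

instance : IsScalarTower P F F :=
  ⟨fun p a b => Quotient.inductionOn₂ a b fun _ _ => mk_eq (.smul_mul _ _ _)⟩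

instance : SMulCommClass P F F :=
  ⟨fun p a b => by
    change p • (a * b) = a * (p • b)
    rw [mul_comm a (p • b), mul_comm a b]
    exact (smul_assoc p b a).symm⟩

instance : Module ℝ F := Module.compHom F (algebraMap ℝ P)

instance : IsScalarTower ℝ P F :=
  ⟨fun r p a => by
    change (r • p) • a = (algebraMap ℝ P r) • (p • a)
    rw [smul_smul, Algebra.smul_def]⟩

theorem dx_add (a b : F) : dx (a + b) = dx a + dx b :=
  Quotient.inductionOn₂ a b fun _ _ => mk_eq (.dx_add _ _)
theorem dx_smul (p : P) (a : F) : dx (p • a) = dP p • a + p • dx a :=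
  Quotient.inductionOn a fun _ => mk_eq (.dx_smul _ _)
theorem dx_mul (a b : F) : dx (a * b) = dx a * b + a * dx b :=
  Quotient.inductionOn₂ a b fun _ _ => mk_eq (.dx_mul _ _)
theorem sh_add (a b : F) : sh (a + b) = sh a + sh b :=
  Quotient.inductionOn₂ a b fun _ _ => mk_eq (.sh_add _ _)
theorem sh_smul (p : P) (a : F) : sh (p • a) = shP p • sh a :=
  Quotient.inductionOn a fun _ => mk_eq (.sh_smul _ _)
theorem sh_mul (a b : F) : sh (a * b) = sh a * sh b :=
  Quotient.inductionOn₂ a b fun _ _ => mk_eq (.sh_mul _ _)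
theorem sh_dx (a : F) : sh (dx a) = dx (sh a) :=
  Quotient.inductionOn a fun _ => mk_eq (.sh_dx _)
theorem dx_dxInv (a : F) : dx (dxInv a) = a :=
  Quotient.inductionOn a fun _ => mk_eq (.dx_dxInv _)
theorem dxInv_dx (a : F) : dxInv (dx a) = a :=
  Quotient.inductionOn a fun _ => mk_eq (.dxInv_dx _)
theorem sh_shInv (a : F) : sh (shInv a) = a :=
  Quotient.inductionOn a fun _ => mk_eq (.sh_shInv _)
theorem shInv_sh (a : F) : shInv (sh a) = a :=
  Quotient.inductionOn a fun _ => mk_eq (.shInv_sh _)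
theorem del_delInv (a : F) : sh (delInv a) - delInv a = a := by
  rw [sub_eq_add_neg]
  exact Quotient.inductionOn a fun _ => mk_eq (.del_delInv _)
theorem delInv_del (a : F) : delInv (sh a - a) = a := by
  rw [sub_eq_add_neg]
  exact Quotient.inductionOn a fun _ => mk_eq (.delInv_del _)

/-! ### Substitution and Gâteaux derivative -/

/-- Evaluation of an expression at `u = w`. -/
def substE (w : F) : Expr → F
  | .u => w
  | .zero => 0
  | .add a b => substE w a + substE w b
  | .smul p a => p • substE w a
  | .mul a b => substE w a * substE w b
  | .dx a => dx (substE w a)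
  | .dxInv a => dxInv (substE w a)
  | .sh a => sh (substE w a)
  | .shInv a => shInv (substE w a)
  | .delInv a => delInv (substE w a)

theorem substE_rel (w : F) {a b : Expr} (r : Rel a b) : substE w a = substE w b := by
  induction r <;> try simp only [substE]
  case symm h => exact h.symm
  case trans h₁ h₂ => exact h₁.trans h₂
  case add_congr h₁ h₂ => rw [h₁, h₂]
  case smul_congr h => rw [h]
  case mul_congr h₁ h₂ => rw [h₁, h₂]
  case dx_congr h => rw [h]
  case dxInv_congr h => rw [h]
  case sh_congr h => rw [h]
  case shInv_congr h => rw [h]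
  case delInv_congr h => rw [h]
  case add_comm => exact add_comm _ _
  case add_assoc => exact add_assoc _ _ _
  case zero_add => exact zero_add _
  case neg_add => simp
  case smul_add => exact smul_add _ _ _
  case add_smul => exact add_smul _ _ _
  case mul_smul => exact mul_smul _ _ _
  case one_smul => exact one_smul _ _
  case mul_comm => exact mul_comm _ _
  case mul_assoc => exact mul_assoc _ _ _
  case mul_add => exact mul_add _ _ _
  case smul_mul => exact smul_mul_assoc _ _ _
  case dx_add => exact dx_add _ _
  case dx_smul => exact dx_smul _ _
  case dx_mul => exact dx_mul _ _
  case sh_add => exact sh_add _ _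
  case sh_smul => exact sh_smul _ _
  case sh_mul => exact sh_mul _ _
  case sh_dx => exact sh_dx _
  case dx_dxInv => exact dx_dxInv _
  case dxInv_dx => exact dxInv_dx _
  case sh_shInv => exact sh_shInv _
  case shInv_sh => exact shInv_sh _
  case del_delInv => rw [neg_one_smul P, ← sub_eq_add_neg, del_delInv]
  case delInv_del => rw [neg_one_smul P, ← sub_eq_add_neg, delInv_del]

/-- The substitution `f(u) ↦ f(w)`. -/
def subst (w : F) : F → F := Quotient.lift (substE w) fun _ _ r => substE_rel w r

/-- The Gâteaux derivative of an expression in the direction `g`, i.e. the coefficient of `ε` in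
`f(u + ε g)` computed modulo `ε²`. -/
def gatE (g : F) : Expr → F
  | .u => g
  | .zero => 0
  | .add a b => gatE g a + gatE g b
  | .smul p a => p • gatE g a
  | .mul a b => gatE g a * mk b + mk a * gatE g b
  | .dx a => dx (gatE g a)
  | .dxInv a => dxInv (gatE g a)
  | .sh a => sh (gatE g a)
  | .shInv a => shInv (gatE g a)
  | .delInv a => delInv (gatE g a)

theorem mk_add (a b : Expr) : mk (.add a b) = mk a + mk b := rfl
theorem mk_mul (a b : Expr) : mk (.mul a b) = mk a * mk b := rfl
theorem mk_smul (p : P) (a : Expr) : mk (.smul p a) = p • mk a := rfl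
theorem mk_dx (a : Expr) : mk (.dx a) = dx (mk a) := rfl
theorem mk_sh (a : Expr) : mk (.sh a) = sh (mk a) := rfl

theorem gatE_rel (g : F) {a b : Expr} (r : Rel a b) : gatE g a = gatE g b := by
  induction r <;> try simp only [gatE, mk_add, mk_mul, mk_smul, mk_dx, mk_sh]
  case symm h => exact h.symm
  case trans h₁ h₂ => exact h₁.trans h₂
  case add_congr h₁ h₂ => rw [h₁, h₂]
  case smul_congr h => rw [h]
  case mul_congr r₁ r₂ h₁ h₂ => rw [h₁, h₂, mk_eq r₁, mk_eq r₂]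
  case dx_congr h => rw [h]
  case dxInv_congr h => rw [h]
  case sh_congr h => rw [h]
  case shInv_congr h => rw [h]
  case delInv_congr h => rw [h]
  case add_comm => exact add_comm _ _
  case add_assoc => exact add_assoc _ _ _
  case zero_add => exact zero_add _
  case neg_add => simp
  case smul_add => exact smul_add _ _ _
  case add_smul => exact add_smul _ _ _
  case mul_smul => exact mul_smul _ _ _
  case one_smul => exact one_smul _ _
  case mul_comm a b => rw [add_comm, mul_comm (mk a), mul_comm (gatE g a)]
  case mul_assoc => simp only [add_mul, mul_add, mul_assoc, add_assoc]
  case mul_add => simp only [mul_add]; abel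
  case smul_mul => simp only [smul_mul_assoc, smul_add]
  case dx_add => exact dx_add _ _
  case dx_smul => exact dx_smul _ _
  case dx_mul => simp only [dx_add, dx_mul]; abel
  case sh_add => exact sh_add _ _
  case sh_smul => exact sh_smul _ _
  case sh_mul => simp only [sh_add, sh_mul]
  case sh_dx => exact sh_dx _
  case dx_dxInv => exact dx_dxInv _
  case dxInv_dx => exact dxInv_dx _
  case sh_shInv => exact sh_shInv _
  case shInv_sh => exact shInv_sh _
  case del_delInv => rw [neg_one_smul P, ← sub_eq_add_neg, del_delInv]
  case delInv_del => rw [neg_one_smul P, ← sub_eq_add_neg, delInv_del]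

/-- The Gâteaux derivative `f'[g]`, as a function of `f` for a given direction `g`. -/
def gat (g : F) : F →ₗ[ℝ] F where
  toFun := Quotient.lift (gatE g) fun _ _ r => gatE_rel g r
  map_add' a b := Quotient.inductionOn₂ a b fun _ _ => rfl
  map_smul' _ a := Quotient.inductionOn a fun _ => rfl

theorem gat_mul (g a b : F) : gat g (a * b) = gat g a * b + a * gat g b :=
  Quotient.inductionOn₂ a b fun _ _ => rfl
theorem gat_smul (g : F) (p : P) (a : F) : gat g (p • a) = p • gat g a :=
  Quotient.inductionOn a fun _ => rfl
theorem gat_dx (g a : F) : gat g (dx a) = dx (gat g a) := Quotient.inductionOn a fun _ => rfl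
theorem gat_sh (g a : F) : gat g (sh a) = sh (gat g a) := Quotient.inductionOn a fun _ => rfl

end F

/-! ### Functionals and the inner product -/

/-- The rules of summation and integration by parts for `∑ₙ ∫ f g dx`. -/
inductive PartsRel : F ⊗[ℝ] F → Prop
  | comm (f g : F) : PartsRel (f ⊗ₜ g - g ⊗ₜ f)
  | assoc (f g k : F) : PartsRel ((f * g) ⊗ₜ k - f ⊗ₜ (g * k))
  | smul (p : P) (f g : F) : PartsRel ((p • f) ⊗ₜ g - f ⊗ₜ (p • g))
  | dx (f g : F) : PartsRel (F.dx f ⊗ₜ g + f ⊗ₜ F.dx g)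
  | sh (f g : F) : PartsRel (F.sh f ⊗ₜ F.sh g - f ⊗ₜ g)

/-- The span of the rules. -/
def partsRel : Submodule ℝ (F ⊗[ℝ] F) := Submodule.span ℝ {z | PartsRel z}

/-- Functionals of `u`: linear combinations of integrals `∑ₙ ∫ f g dx` with `f, g ∈ F`, modulo
summation and integration by parts (there are no boundary terms). -/
abbrev V : Type := (F ⊗[ℝ] F) ⧸ partsRel

/-- The functional `∑ₙ ∫ f g dx`. -/
def sumInt (f g : F) : V := partsRel.mkQ (f ⊗ₜ g)

/-- The inner product `(f, g) = (h² / 2) ∑ₙ ∫ f g dx`. -/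
def pair (h : ℝ) (f g : F) : V := (h ^ 2 / 2) • sumInt f g

/-- The Leibniz rule on `F ⊗ F`. -/
def gatT (g : F) : F ⊗[ℝ] F →ₗ[ℝ] F ⊗[ℝ] F :=
  TensorProduct.map (F.gat g) LinearMap.id + TensorProduct.map LinearMap.id (F.gat g)

theorem gatT_tmul (g a b : F) : gatT g (a ⊗ₜ b) = F.gat g a ⊗ₜ b + a ⊗ₜ F.gat g b := by
  simp [gatT]

theorem gatT_partsRel (g : F) : partsRel ≤ partsRel.comap (gatT g) := by
  refine Submodule.span_le.2 fun z hz => ?_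
  have key : ∀ {w}, PartsRel w → w ∈ partsRel := fun hw => Submodule.subset_span hw
  change gatT g z ∈ partsRel
  obtain ⟨a, b⟩ | ⟨a, b, c⟩ | ⟨p, a, b⟩ | ⟨a, b⟩ | ⟨a, b⟩ := (hz : PartsRel z)
  · convert add_mem (key (.comm (F.gat g a) b)) (key (.comm a (F.gat g b))) using 1
    simp only [map_sub, gatT_tmul]; abel
  · convert add_mem (add_mem (key (.assoc (F.gat g a) b c)) (key (.assoc a (F.gat g b) c)))
      (key (.assoc a b (F.gat g c))) using 1
    simp only [map_sub, gatT_tmul, F.gat_mul, TensorProduct.add_tmul, TensorProduct.tmul_add]; abel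
  · convert add_mem (key (.smul p (F.gat g a) b)) (key (.smul p a (F.gat g b))) using 1
    simp only [map_sub, gatT_tmul, F.gat_smul]; abel
  · convert add_mem (key (.dx (F.gat g a) b)) (key (.dx a (F.gat g b))) using 1
    simp only [map_add, gatT_tmul, F.gat_dx]; abel
  · convert add_mem (key (.sh (F.gat g a) b)) (key (.sh a (F.gat g b))) using 1
    simp only [map_sub, gatT_tmul, F.gat_sh]; abel

/-- The Gâteaux derivative `I'[g]` of a functional `I` in the direction `g`. -/
def gatV (g : F) : V →ₗ[ℝ] V := Submodule.mapQ partsRel partsRel (gatT g) (gatT_partsRel g)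

/-- `f` is the gradient `δI/δu` of the functional `I`: `I'[g] = (f, g)` for all `g`. -/
def HasGradient (h : ℝ) (I : V) (f : F) : Prop := ∀ g : F, gatV g I = pair h f g

open Classical in
/-- The gradient `δI/δu` of a functional that has one. -/
def grad (h : ℝ) (I : V) : F := if c : ∃ f, HasGradient h I f then c.choose else 0

/-- The Poisson bracket `{I, J} = (δI/δu, ∂ δJ/δu)`. -/
def poisson (h : ℝ) (I J : V) : V := pair h (grad h I) (F.dx (grad h J))

/-- `d` is the derivative of `c : ℝ → V` at `t`, tested against all linear forms of `V`. -/
def HasDerivV (c : ℝ → V) (d : V) (t : ℝ) : Prop :=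
  ∀ φ : V →ₗ[ℝ] ℝ, HasDerivAt (fun r => φ (c r)) (φ d) t

/-- `v = ∫₀¹ c(r) dr`, tested against all linear forms of `V`. -/
def IsIntegralV (c : ℝ → V) (v : V) : Prop :=
  ∀ φ : V →ₗ[ℝ] ℝ, IntervalIntegrable (fun r => φ (c r)) MeasureTheory.volume 0 1 ∧
    φ v = ∫ r in (0 : ℝ)..1, φ (c r)

open Classical in
/-- The potential `∫₀¹ (f(λ u), u) dλ` of a function `f`. -/
def potential (h : ℝ) (f : F) : V :=
  if c : ∃ v, IsIntegralV (fun r => pair h (F.subst (r • F.u) f) F.u) v then c.choose else 0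

/-! ### Pseudo-difference operators -/

/-- Coefficients: a polynomial in `x, n` (the value at `u = 0`, read off by `fst`) plus a function
in `F` (read off by `snd`). -/
abbrev R : Type := Unitization P F

namespace R

/-- `∂` on coefficients. -/
def dx (a : R) : R := Unitization.inl (dP a.fst) + Unitization.inr (F.dx a.snd)

/-- The shift `E` on coefficients. -/
def sh : RingAut R where
  toFun a := Unitization.inl (shP a.fst) + Unitization.inr (F.sh a.snd)
  invFun a := Unitization.inl (shP.symm a.fst) + Unitization.inr (F.shInv a.snd)
  left_inv a := by ext <;> simp [F.shInv_sh]
  right_inv a := by ext <;> simp [F.sh_shInv]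
  map_mul' a b := by ext <;> simp [F.sh_add, F.sh_smul, F.sh_mul]
  map_add' a b := by ext <;> simp [F.sh_add]

end R

/-- Pseudo-difference operators `∑_{k ≤ m} a_k E^k`, written in powers of `E` with `a k = a_k`.
Since `Δ = E - 1` and `Δ⁻¹ = E⁻¹ + E⁻² + ⋯`, these are the same as the operators
`∑_{k ≤ m} b_k Δ^k`, with the same order and the same part of nonnegative powers.
All operators used below have coefficients vanishing for large `k`. -/
def Op : Type := ℤ → R

namespace Op

instance : AddCommGroup Op := inferInstanceAs (AddCommGroup (ℤ → R))

/-- The operator of multiplication by a coefficient. -/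
def const (a : R) : Op := fun k => if k = 0 then a else 0

/-- Composition, by `(a E^j) (b E^i) = a (E^j b) E^(j + i)`. -/
instance : Mul Op := ⟨fun a b => fun k => ∑ᶠ j : ℤ, a j * (R.sh ^ j) (b (k - j))⟩

/-- Powers of an operator. -/
def npow (a : Op) : ℕ → Op
  | 0 => const 1
  | m + 1 => a * npow a m

/-- The commutator. -/
def comm (a b : Op) : Op := a * b - b * a

/-- The difference-operator part `(·)₊`. -/
def plus (a : Op) : Op := fun k => if 0 ≤ k then a k else 0

/-- The coefficientwise derivative with respect to `x`. -/
def dx (a : Op) : Op := fun k => R.dx (a k)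

/-- The coefficientwise Gâteaux derivative in the direction `g`. -/
def gat (g : F) (a : Op) : Op := fun k => Unitization.inr (F.gat g (a k).snd)

/-- The operator `Δ = E - 1`. -/
def del : Op := fun k => if k = 1 then 1 else if k = 0 then -1 else 0

end Op

/-- A real constant as a coefficient. -/
def cst (c : ℝ) : R := Unitization.inl (MvPolynomial.C c)

/-! ### The hierarchies -/

/-- The coefficients of `E^(-k)` (for `k = 0`: up to the constant `-h⁻¹`) in the Lax operator,
determined from `u` by `L_x = [A₁, L]`. -/
def laxCoeff (h : ℝ) : ℕ → F
  | 0 => F.u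
  | k + 1 => h • F.delInv
      (F.dx (laxCoeff h k) - laxCoeff h k * (F.u - F.shInv^[k] F.u))

/-- The Lax operator `L = h⁻¹ Δ + u + h u₁ Δ⁻¹ + h² u₂ Δ⁻² + ⋯`, the `u_j` being expressed through
`u` by means of `L_x = [A₁, L]`. -/
def lax (h : ℝ) : Op := fun k =>
  if k = 1 then cst h⁻¹
  else if k = 0 then Unitization.inr F.u - cst h⁻¹
  else if k < 0 then Unitization.inr (laxCoeff h (-k).toNat)
  else 0

/-- `A_m = (L^m)₊`. -/
def opA (h : ℝ) (m : ℕ) : Op := ((lax h).npow m).plus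

theorem Op.mul_apply (a b : Op) (k : ℤ) :
    (a * b) k = ∑ᶠ j : ℤ, a j * (R.sh ^ j) (b (k - j)) := rfl

theorem Op.mul_one' (a : Op) : a * Op.const 1 = a := by
  funext k
  rw [Op.mul_apply, finsum_eq_single _ k]
  · simp [Op.const]
  · intro j hj
    have : k - j ≠ 0 := by omega
    simp [Op.const, this]

theorem opA_one_apply (h : ℝ) (k : ℤ) :
    opA h 1 k = if k = 1 then cst h⁻¹ else if k = 0 then Unitization.inr F.u - cst h⁻¹ else 0 := by
  simp only [opA, Op.npow, Op.mul_one', Op.plus, lax]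
  split_ifs <;> first | rfl | omega

theorem R.sh_cst (c : ℝ) : R.sh (cst c) = cst c := by
  ext
  · simp [R.sh, cst, shP]
  · simp only [R.sh, cst]
    simp
    simpa using F.sh_add 0 0

theorem R.sh_zpow_cst (j : ℤ) (c : ℝ) : (R.sh ^ j) (cst c) = cst c := by
  have key : R.sh ∈ MulAction.stabilizer (RingAut R) (cst c) := R.sh_cst c
  exact (Subgroup.zpow_mem _ key j : R.sh ^ j ∈ MulAction.stabilizer (RingAut R) (cst c))

theorem R.sh_inr (f : F) : R.sh (Unitization.inr f) = Unitization.inr (F.sh f) := by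
  ext <;> simp [R.sh]

theorem R.sh_zpow_neg_inr (i : ℕ) (f : F) :
    (R.sh ^ (-(i : ℤ))) (Unitization.inr f : R) = Unitization.inr (F.shInv^[i] f) := by
  induction i generalizing f with
  | zero => simp
  | succ i ih =>
    have e : R.sh ^ (-((i + 1 : ℕ) : ℤ)) = R.sh ^ (-(i : ℤ)) * R.sh⁻¹ := by
      rw [← zpow_neg_one, ← zpow_add]; congr 1; push_cast; ring
    have e' : R.sh⁻¹ (Unitization.inr f : R) = Unitization.inr (F.shInv f) := by
      change R.sh.symm _ = _
      rw [RingEquiv.symm_apply_eq, R.sh_inr, F.sh_shInv]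
    rw [e, RingAut.mul_apply, e', ih, Function.iterate_succ_apply]

theorem opA_mul (h : ℝ) (a : Op) (k : ℤ) :
    (opA h 1 * a) k = (Unitization.inr F.u - cst h⁻¹) * a k + cst h⁻¹ * R.sh (a (k - 1)) := by
  rw [Op.mul_apply, finsum_eq_sum_of_support_subset (s := {0, 1})]
  · rw [Finset.sum_pair (by norm_num)]
    simp [opA_one_apply]
  · intro j hj
    by_contra hc
    simp only [Finset.coe_insert, Finset.coe_singleton, Set.mem_insert_iff,
      Set.mem_singleton_iff, not_or] at hc
    exact hj (by simp [opA_one_apply, hc.1, hc.2])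

theorem mul_opA (h : ℝ) (a : Op) (k : ℤ) :
    (a * opA h 1) k = a k * ((R.sh ^ k) (Unitization.inr F.u) - cst h⁻¹) + a (k - 1) * cst h⁻¹ := by
  rw [Op.mul_apply, finsum_eq_sum_of_support_subset (s := {k, k - 1})]
  · rw [Finset.sum_pair (by omega)]
    simp [opA_one_apply, R.sh_zpow_cst]
  · intro j hj
    by_contra hc
    simp only [Finset.coe_insert, Finset.coe_singleton, Set.mem_insert_iff,
      Set.mem_singleton_iff, not_or] at hc
    have h1 : k - j ≠ 1 := by omega
    have h2 : k - j ≠ 0 := by omega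
    exact hj (by simp [opA_one_apply, h1, h2])

theorem laxCoeff_succ (h : ℝ) (hh : h ≠ 0) (i : ℕ) :
    h⁻¹ • (F.sh (laxCoeff h (i + 1)) - laxCoeff h (i + 1)) =
      F.dx (laxCoeff h i) - laxCoeff h i * (F.u - F.shInv^[i] F.u) := by
  have e : ∀ f : F, F.sh (h • f) = h • F.sh f := fun f =>
    (F.sh_smul (MvPolynomial.C h) f).trans (by simp [shP]; rfl)
  rw [laxCoeff, e, ← smul_sub, F.del_delInv, smul_smul, inv_mul_cancel₀ hh, one_smul]

theorem cst_mul_inr (c : ℝ) (f : F) :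
    cst c * (Unitization.inr f : R) = Unitization.inr (c • f) := by
  rw [cst, Unitization.inl_mul_inr]; rfl

theorem R.dx_inr (f : F) : R.dx (Unitization.inr f) = Unitization.inr (F.dx f) := by
  simp [R.dx, dP]

theorem R.dx_add (a b : R) : R.dx (a + b) = R.dx a + R.dx b := by
  ext <;> simp [R.dx, dP, F.dx_add]

theorem R.dx_cst (c : ℝ) : R.dx (cst c) = 0 := by
  ext
  · simp [R.dx, cst, dP]
  · simp only [R.dx, cst]
    simp
    simpa using F.dx_add 0 0

theorem lax_dx_aux {S : Type} [CommRing S] {K U W C D C' T : S}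
    (key : K * (T - C') = D - C * (U - W)) :
    D = (U - K) * C + K * T - (C * (W - K) + C' * K) := by
  linear_combination -key

theorem lax_dx_aux_zero {S : Type} [CommRing S] {K U C D C' T : S}
    (key : K * (T - C') = D - C * (U - U)) :
    D = (U - K) * (C - K) + K * T - ((C - K) * (U - K) + C' * K) := by
  linear_combination -key

theorem inr_sub' (a b : F) : (Unitization.inr (a - b) : R) = Unitization.inr a - Unitization.inr b :=
  Unitization.inr_sub P a b

theorem inr_mul' (a b : F) : (Unitization.inr (a * b) : R) = Unitization.inr a * Unitization.inr b :=
  Unitization.inr_mul P a b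

theorem lax_dx_coeff (h : ℝ) (hh : h ≠ 0) (i : ℕ) :
    cst h⁻¹ * ((Unitization.inr (F.sh (laxCoeff h (i + 1))) : R) -
      Unitization.inr (laxCoeff h (i + 1))) =
    Unitization.inr (F.dx (laxCoeff h i)) - Unitization.inr (laxCoeff h i) *
      (Unitization.inr F.u - Unitization.inr (F.shInv^[i] F.u)) := by
  rw [← inr_sub', ← inr_sub', ← inr_mul', ← inr_sub', cst_mul_inr, laxCoeff_succ h hh]

theorem lax_dx_aux_one {S : Type} [CommRing S] {K U W : S} :
    0 = (U - K) * K + K * (W - K) - (K * (W - K) + (U - K) * K) := by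
  ring

theorem lax_dx_aux_two {S : Type} [CommRing S] {A B C K : S} :
    0 = A * 0 + K * B - (0 * C + B * K) := by
  ring

/-- The Lax operator does satisfy `L_x = [A₁, L]`. -/
theorem lax_dx (h : ℝ) (hh : h ≠ 0) : (lax h).dx = (opA h 1).comm (lax h) := by
  funext k
  change R.dx (lax h k) = (opA h 1 * lax h) k - (lax h * opA h 1) k
  rw [opA_mul, mul_opA]
  rcases lt_trichotomy k 1 with hk | rfl | hk
  · obtain ⟨i, rfl⟩ : ∃ i : ℕ, k = -(i : ℤ) := ⟨(-k).toNat, by omega⟩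
    have e1 : lax h (-(i : ℤ) - 1) = Unitization.inr (laxCoeff h (i + 1)) := by
      simp only [lax]
      rw [if_neg (by omega), if_neg (by omega), if_pos (by omega)]
      congr 2; omega
    have e2 : lax h (-(i : ℤ)) = Unitization.inr (laxCoeff h i) - if i = 0 then cst h⁻¹ else 0 := by
      rcases i with _ | i
      · simp [lax, laxCoeff]
      · simp only [lax]
        rw [if_neg (by omega), if_neg (by omega), if_pos (by omega)]
        simp
    have e3 : R.dx (lax h (-(i : ℤ))) = Unitization.inr (F.dx (laxCoeff h i)) := by
      rw [e2, sub_eq_add_neg, R.dx_add, R.dx_inr]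
      split_ifs
      · rw [show -cst h⁻¹ = cst (-h⁻¹) by simp [cst], R.dx_cst, add_zero]
      · have := R.dx_cst 0
        simpa [cst] using this
    have key := lax_dx_coeff h hh i
    rw [e3, e1, e2, R.sh_zpow_neg_inr, R.sh_inr]
    rcases i with _ | i
    · rw [if_pos rfl]
      exact lax_dx_aux_zero key
    · rw [if_neg (Nat.succ_ne_zero i), sub_zero]
      exact lax_dx_aux key
  · have e1 : lax h 1 = cst h⁻¹ := rfl
    have e0 : lax h (1 - 1) = Unitization.inr F.u - cst h⁻¹ := rfl
    rw [e1, e0, R.dx_cst, map_sub, R.sh_cst, zpow_one]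
    exact lax_dx_aux_one
  · have e1 : lax h k = 0 := by
      simp only [lax]; rw [if_neg (by omega), if_neg (by omega), if_neg (by omega)]
    have e2 : R.sh (lax h (k - 1)) = lax h (k - 1) := by
      by_cases h2 : k = 2
      · subst h2
        exact R.sh_cst h⁻¹
      · have e0 : lax h (k - 1) = 0 := by
          simp only [lax]; rw [if_neg (by omega), if_neg (by omega), if_neg (by omega)]
        rw [e0, map_zero]
    rw [e1, e2]
    rw [show R.dx 0 = 0 by simpa [cst] using R.dx_cst 0]
    exact lax_dx_aux_two

/-- The operator `A_{m,x} - [A₁, A_m]`. -/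
def zcA (h : ℝ) (m : ℕ) : Op := (opA h m).dx - (opA h 1).comm (opA h m)

/-- The isospectral flow `K_m = A_{m,x} - [A₁, A_m]`. -/
def flowK (h : ℝ) (m : ℕ) : F := (zcA h m 0).snd

/-- The asymptotic value `h^{-(m-1)} x Δ^m + h^{-(m-1)} (x + h n) Δ^{m-1}` of `B_m` at `u = 0`. -/
def asymB (h : ℝ) (m : ℕ) : Op :=
  Op.const (Unitization.inl (MvPolynomial.C (h⁻¹ ^ (m - 1)) * varX)) * Op.del.npow m +
  Op.const (Unitization.inl (MvPolynomial.C (h⁻¹ ^ (m - 1)) * (varX + MvPolynomial.C h * varN))) *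
    Op.del.npow (m - 1)

/-- `B` is the operator `B_m` and `σ` the flow `σ_m` of the non-isospectral hierarchy: `B` is a
difference operator of order at most `m` with the prescribed value at `u = 0`, and under
`u_t = σ` the compatibility conditions `L_t = [B, L] + h L^m + L^{m-1}` and
`σ = A_{1,t} = B_x - [A₁, B]` hold. -/
structure IsNonisospectral (h : ℝ) (m : ℕ) (B : Op) (σ : F) : Prop where
  order : ∀ k : ℤ, k < 0 ∨ (m : ℤ) < k → B k = 0
  asym : ∀ k : ℤ, (B k).fst = (asymB h m k).fst
  compat : (lax h).gat σ =
    B.comm (lax h) + Op.const (cst h) * (lax h).npow m + (lax h).npow (m - 1)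
  zeroCurv : B.dx - (opA h 1).comm B = Op.const (Unitization.inr σ)

/-- The non-isospectral flow `σ_m`. -/
def flowS (h : ℝ) (m : ℕ) : F :=
  (@Classical.epsilon (Op × F) ⟨(0, 0)⟩ fun q => IsNonisospectral h m q.1 q.2).2

/-! ### Hamiltonians and conserved quantities -/

/-- `γ_s = ∂⁻¹ K_s`. -/
def gam (h : ℝ) (s : ℕ) : F := F.dxInv (flowK h s)

/-- `ω_s = ∂⁻¹ σ_s`. -/
def omg (h : ℝ) (s : ℕ) : F := F.dxInv (flowS h s)

/-- The Hamiltonians `H_s`: `H_0 = 0`, `H_1 = (u, u) / 2` and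
`H_s = h⁻¹ ((γ_{s-1}, σ_2) / (s - 1) - H_{s-1})` for `s > 1`. -/
def hamH (h : ℝ) : ℕ → V
  | 0 => 0
  | 1 => (1 / 2 : ℝ) • pair h F.u F.u
  | s + 2 => h⁻¹ • ((1 / ((s : ℝ) + 1)) • pair h (gam h (s + 1)) (flowS h 2) - hamH h (s + 1))

/-- The Hamiltonians `J_s`: `J_0 = 0`, `J_1 = (h / 2) (x u, u)`, `J_3 = ∫₀¹ (ω_3(λ u), u) dλ` and
`J_s = h⁻¹ ((ω_{s-1}, σ_2) / (s - 3) - J_{s-1})` for `s > 1`, `s ≠ 3`. -/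
def hamJ (h : ℝ) : ℕ → V
  | 0 => 0
  | 1 => (h / 2) • pair h (varX • F.u) F.u
  | 2 => h⁻¹ • ((1 / ((2 : ℝ) - 3)) • pair h (omg h 1) (flowS h 2) - hamJ h 1)
  | 3 => potential h (omg h 3)
  | s + 4 => h⁻¹ • ((1 / ((s : ℝ) + 1)) • pair h (omg h (s + 3)) (flowS h 2) - hamJ h (s + 3))

/-- The functionals `I^s_r = s t (h H_{s+r-1} + H_{s+r-2}) + J_r` for `r ≥ 1`, depending on the
time `t = t_s`; and `I^s_0 = 0`. -/
def consI (h : ℝ) (s r : ℕ) (t : ℝ) : V :=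
  if r = 0 then 0
  else ((s : ℝ) * t) • (h • hamH h (s + r - 1) + hamH h (s + r - 2)) + hamJ h r

/-- The functional `I`, possibly depending explicitly on the time `t`, is a conserved quantity of
`u_t = K`: its total time derivative `∂I/∂t + I'[K]` (explicit derivative plus derivative along the
flow) vanishes at all times. -/
def IsConserved (K : F) (I : ℝ → V) : Prop :=
  ∀ t : ℝ, ∃ d : V, HasDerivV I d t ∧ d + gatV K (I t) = 0

/-- The subspace `W` of `M` is a Lie algebra for the operation `br`. -/
structure IsLieAlg {M : Type} [AddCommGroup M] [Module ℝ M] (br : M → M → M)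
    (W : Submodule ℝ M) : Prop where
  closed : ∀ a ∈ W, ∀ b ∈ W, br a b ∈ W
  add_left : ∀ a ∈ W, ∀ b ∈ W, ∀ c ∈ W, br (a + b) c = br a c + br b c
  smul_left : ∀ (r : ℝ), ∀ a ∈ W, ∀ b ∈ W, br (r • a) b = r • br a b
  add_right : ∀ a ∈ W, ∀ b ∈ W, ∀ c ∈ W, br a (b + c) = br a b + br a c
  smul_right : ∀ (r : ℝ), ∀ a ∈ W, ∀ b ∈ W, br a (r • b) = r • br a b
  self : ∀ a ∈ W, br a a = 0
  jacobi : ∀ a ∈ W, ∀ b ∈ W, ∀ c ∈ W, br a (br b c) + br b (br c a) + br c (br a b) = 0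

end

end DDKP

/-! Everything rests on the covariant derivative `∂ - [A₁, ·]` (`cov`), a derivation of the ring of
operators of bounded order. Since `Δ` is invertible on functions vanishing at `u = 0`, a covariantly
constant operator is determined by its value at `u = 0` (`eq_zero_of_cov`), and for every function
`g` there is an operator of negative order with covariant derivative `g` (`cov_dress`). Identities
between covariantly constant operators therefore need checking only at `u = 0`. The Lax operator `L`
is one such operator; the Orlov-Schulman operator `M = x E + h n + ⋯` is a second. At `u = 0` one
reads off `[L, M] = 1 + h L` (`lie_bL_bM`), whence the commutators of the `L^l` and `M L^j` have the
structure constants of the theorem (`lie_pow_bL_bN`, `lie_bN_bN`).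

For such an operator `D`, let `ω(D)` be the part in `F` of its coefficient of `E⁰`. The covariant
derivative of `D₊` is multiplication by `∂ω(D)` (`cov_plus`); so `K_m` comes from `L^m`, and `σ_m`,
`B_m` come from `M L^(m-1)`. The flow `∂ω(D)` moves every other `D'` by `[D', D₋]` (`gat_flow`), and
at order zero this turns commutators of flows into commutators of operators (`gat_omega_sub`). The
invariant trace form makes the derivative of `ω(D)` self-adjoint (`omega_mem_selfAdj`), so `(ω(D),
∂ω(D'))` has gradient `ω([D, D'])` (`hasGradient_pair_omega`). Read with `D' = M L`, this is the
recursion defining `H_s` and `J_s`. It degenerates only at `J_3`, where the homotopy formula takes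
over (`hasGradient_potential`).

Finally, every functional is a sum of parts of positive degree in `u`, so it is determined by its
gradient (`HasGradient.unique`). Hence brackets of Hamiltonians are read off from commutators of
operators (`poisson_eq_of_flat`); conservation laws and closure are bilinear consequences, and the
Jacobi identity follows from the commutator formula for directional derivatives (`gatV_gatV_sub`).
-/

namespace DDKP
noncomputable section

/-! ### The ring of operators of bounded order -/

/-- The operators whose coefficients vanish in large orders. -/
def bddOp : AddSubgroup Op where
  carrier := {a | ∃ N : ℤ, ∀ k, N < k → a k = 0}
  zero_mem' := ⟨0, fun _ _ => rfl⟩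
  add_mem' := by
    rintro a b ⟨N, hN⟩ ⟨M, hM⟩
    refine ⟨max N M, fun k hk => ?_⟩
    change a k + b k = 0
    rw [hN k (lt_of_le_of_lt (le_max_left _ _) hk), hM k (lt_of_le_of_lt (le_max_right _ _) hk),
      add_zero]
  neg_mem' := by
    rintro a ⟨N, hN⟩
    refine ⟨N, fun k hk => ?_⟩
    change - a k = 0
    rw [hN k hk, neg_zero]

/-- Operators of bounded order. -/
abbrev BOp : Type := bddOp

namespace Op

/-- The free shift `i` and free bounds `lo`, `hi` let sums attached to different outer indices run
over one common window, so that double sums can be interchanged. -/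
theorem mul_apply_eq_sum {a b : Op} {N M : ℤ} (ha : ∀ k, N < k → a k = 0)
    (hb : ∀ k, M < k → b k = 0) (k i : ℤ) {lo hi : ℤ} (hlo : lo ≤ k - M + i) (hhi : N + i ≤ hi) :
    (a * b) k = ∑ j ∈ Finset.Icc lo hi, a (j - i) * (R.sh ^ (j - i)) (b (k - (j - i))) := by
  rw [mul_apply, ← finsum_comp_equiv (Equiv.subRight i)]
  refine finsum_eq_sum_of_support_subset _ fun j hj => ?_
  simp only [Equiv.subRight_apply, Function.mem_support] at hj
  simp only [Finset.coe_Icc, Set.mem_Icc]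
  constructor
  · by_contra hc
    exact hj (by rw [hb _ (by omega), map_zero, mul_zero])
  · by_contra hc
    exact hj (by rw [ha _ (by omega), zero_mul])

theorem mul_eq_zero_of_lt {a b : Op} {N M : ℤ} (ha : ∀ k, N < k → a k = 0)
    (hb : ∀ k, M < k → b k = 0) (k : ℤ) (hk : N + M < k) : (a * b) k = 0 := by
  rw [mul_apply_eq_sum ha hb k 0 (lo := k - M) (hi := N) (by omega) (by omega),
    Finset.Icc_eq_empty (by omega), Finset.sum_empty]

theorem one_mul' (a : Op) : Op.const 1 * a = a := by
  funext k
  rw [mul_apply, finsum_eq_single _ 0]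
  · simp [const]
  · intro j hj
    simp [const, hj]

end Op

namespace BOp

instance : Mul BOp :=
  ⟨fun a b => ⟨a.1 * b.1, a.2.choose + b.2.choose,
    Op.mul_eq_zero_of_lt a.2.choose_spec b.2.choose_spec⟩⟩

instance : One BOp := ⟨⟨Op.const 1, 0, fun _ hk => if_neg hk.ne'⟩⟩

theorem ext {a b : BOp} (H : ∀ k, a.1 k = b.1 k) : a = b := Subtype.ext (funext H)

theorem coe_mul (a b : BOp) : (a * b).1 = a.1 * b.1 := rfl
theorem coe_one : (1 : BOp).1 = Op.const 1 := rfl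
theorem add_apply (a b : BOp) (k : ℤ) : (a + b).1 k = a.1 k + b.1 k := rfl
theorem sub_apply (a b : BOp) (k : ℤ) : (a - b).1 k = a.1 k - b.1 k := rfl
theorem neg_apply (a : BOp) (k : ℤ) : (-a).1 k = -a.1 k := rfl
theorem zero_apply (k : ℤ) : (0 : BOp).1 k = 0 := rfl

/-- Both sides are the sum over `i, j` of `a_i (E^i b_(j-i)) (E^j c_(k-j))`, and boundedness gives a
finite rectangle of indices that works for either order of summation. -/
protected theorem mul_assoc' (a b c : BOp) : a * b * c = a * (b * c) := by
  obtain ⟨a, A, ha⟩ := a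
  obtain ⟨b, B, hb⟩ := b
  obtain ⟨c, C, hc⟩ := c
  refine ext fun k => ?_
  change ((a * b) * c) k = (a * (b * c)) k
  rw [Op.mul_apply_eq_sum (Op.mul_eq_zero_of_lt ha hb) hc k 0 (lo := k - C) (hi := A + B)
    (by omega) (by omega), Op.mul_apply_eq_sum ha (Op.mul_eq_zero_of_lt hb hc) k 0
    (lo := k - C - B) (hi := A) (by omega) (by omega)]
  have e1 : ∀ j ∈ Finset.Icc (k - C) (A + B),
      (a * b) (j - 0) * (R.sh ^ (j - 0)) (c (k - (j - 0))) =
      ∑ i ∈ Finset.Icc (k - C - B) A,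
        a i * (R.sh ^ i) (b (j - i)) * (R.sh ^ j) (c (k - j)) := fun j hj => by
    rw [Finset.mem_Icc] at hj
    rw [Op.mul_apply_eq_sum ha hb (j - 0) 0 (lo := k - C - B) (hi := A) (by omega) (by omega),
      Finset.sum_mul]
    simp only [sub_zero]
  have e2 : ∀ i ∈ Finset.Icc (k - C - B) A,
      a (i - 0) * (R.sh ^ (i - 0)) ((b * c) (k - (i - 0))) =
      ∑ j ∈ Finset.Icc (k - C) (A + B),
        a i * (R.sh ^ i) (b (j - i)) * (R.sh ^ j) (c (k - j)) := fun i hi => by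
    rw [Finset.mem_Icc] at hi
    rw [Op.mul_apply_eq_sum hb hc (k - (i - 0)) i (lo := k - C) (hi := A + B) (by omega)
      (by omega), map_sum, Finset.mul_sum]
    refine Finset.sum_congr rfl fun j _ => ?_
    rw [map_mul, sub_zero, ← RingAut.mul_apply, ← zpow_add, mul_assoc]
    congr 3
    · congr 1; omega
    · congr 1; omega
  rw [Finset.sum_congr rfl e1, Finset.sum_congr rfl e2, Finset.sum_comm]

protected theorem left_distrib' (a b c : BOp) : a * (b + c) = a * b + a * c := by
  obtain ⟨a, A, ha⟩ := a
  obtain ⟨b, B, hb⟩ := b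
  obtain ⟨c, C, hc⟩ := c
  refine ext fun k => ?_
  change (a * (b + c)) k = (a * b) k + (a * c) k
  have hb' : ∀ k, max B C < k → b k = 0 := fun k hk => hb k (by omega)
  have hc' : ∀ k, max B C < k → c k = 0 := fun k hk => hc k (by omega)
  have hbc : ∀ k, max B C < k → (b + c) k = 0 := fun k hk => by
    change b k + c k = 0
    rw [hb' k hk, hc' k hk, add_zero]
  rw [Op.mul_apply_eq_sum ha hb' k 0 le_rfl le_rfl, Op.mul_apply_eq_sum ha hc' k 0 le_rfl le_rfl,
    Op.mul_apply_eq_sum ha hbc k 0 le_rfl le_rfl, ← Finset.sum_add_distrib]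
  refine Finset.sum_congr rfl fun j _ => ?_
  rw [← mul_add, ← map_add]
  rfl

protected theorem right_distrib' (a b c : BOp) : (a + b) * c = a * c + b * c := by
  obtain ⟨a, A, ha⟩ := a
  obtain ⟨b, B, hb⟩ := b
  obtain ⟨c, C, hc⟩ := c
  refine ext fun k => ?_
  change ((a + b) * c) k = (a * c) k + (b * c) k
  have ha' : ∀ k, max A B < k → a k = 0 := fun k hk => ha k (by omega)
  have hb' : ∀ k, max A B < k → b k = 0 := fun k hk => hb k (by omega)
  have hab : ∀ k, max A B < k → (a + b) k = 0 := fun k hk => by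
    change a k + b k = 0
    rw [ha' k hk, hb' k hk, add_zero]
  rw [Op.mul_apply_eq_sum ha' hc k 0 le_rfl le_rfl, Op.mul_apply_eq_sum hb' hc k 0 le_rfl le_rfl,
    Op.mul_apply_eq_sum hab hc k 0 le_rfl le_rfl, ← Finset.sum_add_distrib]
  refine Finset.sum_congr rfl fun j _ => ?_
  rw [← add_mul]
  rfl

instance : Ring BOp where
  __ := AddSubgroup.toAddCommGroup bddOp
  mul_assoc := BOp.mul_assoc'
  one_mul a := Subtype.ext (Op.one_mul' a.1)
  mul_one a := Subtype.ext (Op.mul_one' a.1)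
  left_distrib := BOp.left_distrib'
  right_distrib := BOp.right_distrib'
  zero_mul a := by
    have e := BOp.right_distrib' 0 0 a
    rw [add_zero] at e
    simpa using e
  mul_zero a := by
    have e := BOp.left_distrib' a 0 0
    rw [add_zero] at e
    simpa using e

theorem coe_pow (a : BOp) (m : ℕ) : (a ^ m).1 = a.1.npow m := by
  induction m with
  | zero => rfl
  | succ m ih => rw [pow_succ', coe_mul, ih]; rfl

/-! ### Coefficientwise maps -/

theorem map_sh_zpow {φ : R →+ R} (hs : ∀ a, φ (R.sh a) = R.sh (φ a)) (j : ℤ) (a : R) :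
    φ ((R.sh ^ j) a) = (R.sh ^ j) (φ a) := by
  induction j generalizing a with
  | zero => rfl
  | succ i ih =>
    rw [zpow_add_one, RingAut.mul_apply, ih, hs]; rfl
  | pred i ih =>
    rw [zpow_sub_one, RingAut.mul_apply, ih, RingAut.mul_apply]
    congr 1
    apply R.sh.injective
    rw [← hs]
    change φ (R.sh (R.sh.symm a)) = R.sh (R.sh.symm (φ a))
    rw [RingEquiv.apply_symm_apply, RingEquiv.apply_symm_apply]

/-- The coefficientwise action of an additive map. -/
def map (φ : R →+ R) : BOp →+ BOp where
  toFun a := ⟨fun k => φ (a.1 k), a.2.choose, fun k hk => by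
    change φ (a.1 k) = 0
    rw [a.2.choose_spec k hk, map_zero]⟩
  map_zero' := ext fun _ => map_zero φ
  map_add' a b := ext fun k => map_add φ (a.1 k) (b.1 k)

theorem map_apply (φ : R →+ R) (a : BOp) (k : ℤ) : (map φ a).1 k = φ (a.1 k) := rfl

theorem map_mul_of_derivation {φ : R →+ R} (hs : ∀ a, φ (R.sh a) = R.sh (φ a))
    (hφ : ∀ a b, φ (a * b) = φ a * b + a * φ b) (a b : BOp) :
    map φ (a * b) = map φ a * b + a * map φ b := by
  refine ext fun k => ?_
  obtain ⟨A, ha⟩ := a.2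
  obtain ⟨B, hb⟩ := b.2
  have ha' : ∀ k, A < k → (map φ a).1 k = 0 := fun k hk => by rw [map_apply, ha k hk, map_zero]
  have hb' : ∀ k, B < k → (map φ b).1 k = 0 := fun k hk => by rw [map_apply, hb k hk, map_zero]
  rw [add_apply, map_apply, coe_mul, coe_mul, coe_mul, Op.mul_apply_eq_sum ha hb k 0 le_rfl le_rfl,
    Op.mul_apply_eq_sum ha' hb k 0 le_rfl le_rfl, Op.mul_apply_eq_sum ha hb' k 0 le_rfl le_rfl, map_sum,
    ← Finset.sum_add_distrib]
  refine Finset.sum_congr rfl fun j _ => ?_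
  rw [hφ, map_sh_zpow hs]; rfl

theorem map_mul_of_mul {φ : R →+ R} (hs : ∀ a, φ (R.sh a) = R.sh (φ a))
    (hφ : ∀ a b, φ (a * b) = φ a * φ b) (a b : BOp) :
    map φ (a * b) = map φ a * map φ b := by
  refine ext fun k => ?_
  obtain ⟨A, ha⟩ := a.2
  obtain ⟨B, hb⟩ := b.2
  have ha' : ∀ k, A < k → (map φ a).1 k = 0 := fun k hk => by rw [map_apply, ha k hk, map_zero]
  have hb' : ∀ k, B < k → (map φ b).1 k = 0 := fun k hk => by rw [map_apply, hb k hk, map_zero]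
  rw [map_apply, coe_mul, coe_mul, Op.mul_apply_eq_sum ha hb k 0 le_rfl le_rfl,
    Op.mul_apply_eq_sum ha' hb' k 0 le_rfl le_rfl, map_sum]
  refine Finset.sum_congr rfl fun j _ => ?_
  rw [hφ, map_sh_zpow hs]; rfl

end BOp

/-! ### Additivity and real homogeneity of `∂` and `E` -/

namespace F

theorem sh_zero : sh 0 = 0 := by simpa using sh_add 0 0
theorem dx_zero : dx 0 = 0 := by simpa using dx_add 0 0
theorem delInv_zero : delInv 0 = 0 := by
  have e := delInv_del 0
  rwa [sh_zero, sub_zero] at e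
theorem dx_neg (a : F) : dx (-a) = -dx a := by
  rw [eq_neg_iff_add_eq_zero, ← dx_add, neg_add_cancel, dx_zero]
theorem dx_sub (a b : F) : dx (a - b) = dx a - dx b := by
  rw [sub_eq_add_neg, dx_add, dx_neg, sub_eq_add_neg]
theorem sh_neg (a : F) : sh (-a) = -sh a := by
  rw [eq_neg_iff_add_eq_zero, ← sh_add, neg_add_cancel, sh_zero]
theorem dx_rsmul (r : ℝ) (a : F) : dx (r • a) = r • dx a := by
  change dx ((MvPolynomial.C r : P) • a) = (MvPolynomial.C r : P) • dx a
  simp [dx_smul, dP]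
theorem sh_rsmul (r : ℝ) (a : F) : sh (r • a) = r • sh a := by
  change sh ((MvPolynomial.C r : P) • a) = (MvPolynomial.C r : P) • sh a
  rw [sh_smul]
  simp [shP]
end F

/-! ### Derivations and the augmentation on coefficients -/

namespace R

theorem fst_sub (a b : R) : (a - b).fst = a.fst - b.fst := rfl
theorem snd_sub (a b : R) : (a - b).snd = a.snd - b.snd := rfl
theorem fst_sum {ι : Type*} (s : Finset ι) (f : ι → R) : (∑ i ∈ s, f i).fst = ∑ i ∈ s, (f i).fst :=
  map_sum (⟨⟨fun a : R => a.fst, rfl⟩, fun _ _ => rfl⟩ : R →+ P) f s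
theorem snd_sum {ι : Type*} (s : Finset ι) (f : ι → R) : (∑ i ∈ s, f i).snd = ∑ i ∈ s, (f i).snd :=
  map_sum (⟨⟨fun a : R => a.snd, rfl⟩, fun _ _ => rfl⟩ : R →+ F) f s
theorem fst_sh (a : R) : (R.sh a).fst = shP a.fst := by simp [R.sh]
theorem snd_sh (a : R) : (R.sh a).snd = F.sh a.snd := by simp [R.sh]
theorem fst_dx (a : R) : (R.dx a).fst = dP a.fst := by simp [R.dx]
theorem snd_dx (a : R) : (R.dx a).snd = F.dx a.snd := by simp [R.dx]

theorem dP_shP (p : P) : dP (shP p) = shP (dP p) := by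
  induction p using MvPolynomial.induction_on with
  | C a => simp [dP, shP]
  | add p q hp hq => simp only [dP, map_add] at *; rw [hp, hq]
  | mul_X p i hp =>
    simp only [dP, map_mul, Derivation.leibniz, map_add, smul_eq_mul] at *
    rw [hp]
    congr 2
    fin_cases i <;> simp [shP, MvPolynomial.pderiv_X]

/-- `∂` on coefficients, as an additive map. -/
def dxHom : R →+ R where
  toFun := R.dx
  map_zero' := by simpa [cst] using R.dx_cst 0
  map_add' := R.dx_add

/-- The Gâteaux derivative on coefficients. -/
def gatHom (g : F) : R →+ R where
  toFun a := Unitization.inr (F.gat g a.snd)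
  map_zero' := by simp
  map_add' a b := by simp

/-- The value of a coefficient at `u = 0`. -/
def augHom : R →+ R where
  toFun a := Unitization.inl a.fst
  map_zero' := by simp
  map_add' a b := by simp

theorem dxHom_sh (a : R) : dxHom (R.sh a) = R.sh (dxHom a) := by
  change R.dx (R.sh a) = R.sh (R.dx a)
  refine Unitization.ext ?_ ?_
  · rw [fst_dx, fst_sh, fst_sh, fst_dx, dP_shP]
  · rw [snd_dx, snd_sh, snd_sh, snd_dx, F.sh_dx]

theorem dxHom_mul (a b : R) : dxHom (a * b) = dxHom a * b + a * dxHom b := by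
  change R.dx (a * b) = R.dx a * b + a * R.dx b
  refine Unitization.ext ?_ ?_
  · simp only [fst_dx, dP, Unitization.fst_mul, Unitization.fst_add, Derivation.leibniz,
      smul_eq_mul]
    ring
  · simp only [snd_dx, fst_dx, Unitization.snd_mul, Unitization.snd_add, F.dx_add, F.dx_smul,
      F.dx_mul]
    abel

theorem gatHom_sh (g : F) (a : R) : gatHom g (R.sh a) = R.sh (gatHom g a) := by
  change (Unitization.inr (F.gat g (R.sh a).snd) : R) = R.sh (Unitization.inr (F.gat g a.snd))
  rw [snd_sh, F.gat_sh, R.sh_inr]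

theorem gatHom_mul (g : F) (a b : R) : gatHom g (a * b) = gatHom g a * b + a * gatHom g b := by
  refine Unitization.ext ?_ ?_
  · simp [gatHom]
  · simp only [gatHom, AddMonoidHom.coe_mk, ZeroHom.coe_mk, Unitization.snd_mul,
      Unitization.snd_add, Unitization.snd_inr, Unitization.fst_inr, map_add, F.gat_mul,
      F.gat_smul, zero_smul]
    abel

theorem augHom_sh (a : R) : augHom (R.sh a) = R.sh (augHom a) := by
  change (Unitization.inl (R.sh a).fst : R) = R.sh (Unitization.inl a.fst)
  refine Unitization.ext ?_ ?_
  · simp [fst_sh]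
  · rw [snd_sh]
    simp [F.sh_zero]

theorem augHom_mul (a b : R) : augHom (a * b) = augHom a * augHom b := by
  exact Unitization.inl_mul F a.fst b.fst

end R

/-! ### Coefficients, the shift and coefficientwise operations on operators -/

namespace BOp

/-- Multiplication by coefficients. -/
def const : R →+* BOp where
  toFun a := ⟨Op.const a, 0, fun _ hk => if_neg hk.ne'⟩
  map_one' := rfl
  map_zero' := ext fun k => by
    change (if k = 0 then (0 : R) else 0) = 0
    simp
  map_add' a b := ext fun k => by
    change (if k = 0 then a + b else 0) = (if k = 0 then a else 0) + if k = 0 then b else 0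
    split_ifs <;> simp
  map_mul' a b := ext fun k => by
    change (if k = 0 then a * b else 0) =
      ∑ᶠ j : ℤ, (if j = 0 then a else 0) * (R.sh ^ j) (if k - j = 0 then b else 0)
    rw [finsum_eq_single _ 0 fun j hj => by rw [if_neg hj, zero_mul]]
    simp

theorem const_apply (a : R) (k : ℤ) : (const a).1 k = if k = 0 then a else 0 := rfl

theorem const_mul_apply (a : R) (b : BOp) (k : ℤ) : (const a * b).1 k = a * b.1 k := by
  rw [coe_mul, Op.mul_apply, finsum_eq_single _ 0]
  · simp [const_apply]
  · intro j hj
    rw [const_apply, if_neg hj, zero_mul]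

theorem mul_const_apply (a : R) (b : BOp) (k : ℤ) :
    (b * const a).1 k = b.1 k * (R.sh ^ k) a := by
  rw [coe_mul, Op.mul_apply, finsum_eq_single _ k]
  · simp [const_apply]
  · intro j hj
    rw [const_apply, if_neg (by omega), map_zero, mul_zero]

/-- The shift as an operator. -/
def E : BOp := ⟨fun k => if k = 1 then 1 else 0, 1, fun _ hk => if_neg (by omega)⟩

theorem E_apply (k : ℤ) : E.1 k = if k = 1 then 1 else 0 := rfl

theorem E_mul_const (a : R) : E * const a = const (R.sh a) * E := by
  refine ext fun k => ?_
  rw [const_mul_apply, mul_const_apply, E_apply]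
  split_ifs with hk
  · rw [hk, zpow_one, one_mul, mul_one]
  · simp

theorem const_cst_comm (c : ℝ) (a : BOp) : const (cst c) * a = a * const (cst c) := by
  refine ext fun k => ?_
  rw [const_mul_apply, mul_const_apply, R.sh_zpow_cst, mul_comm]

/-- The value of an operator at `u = 0`. -/
def aug : BOp →+* BOp where
  __ := map R.augHom
  map_one' := ext fun k => by
    change R.augHom ((const 1).1 k) = (const 1).1 k
    rw [const_apply]
    split_ifs
    · change (Unitization.inl (1 : R).fst : R) = 1
      simp
    · simp
  map_mul' := map_mul_of_mul R.augHom_sh R.augHom_mul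

theorem aug_apply (a : BOp) (k : ℤ) : (aug a).1 k = Unitization.inl (a.1 k).fst := rfl

theorem aug_eq_zero {a : BOp} : aug a = 0 ↔ ∀ k, (a.1 k).fst = 0 := by
  constructor
  · intro H k
    have e := aug_apply a k
    rw [H, zero_apply] at e
    have := congrArg (fun r : R => r.fst) e
    simpa using this.symm
  · intro H
    refine ext fun k => ?_
    rw [aug_apply, H, Unitization.inl_zero, zero_apply]

theorem aug_const (a : R) : aug (const a) = const (Unitization.inl a.fst) := by
  refine ext fun k => ?_
  rw [aug_apply, const_apply, const_apply]
  split_ifs <;> simp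

/-- The coefficientwise `x`-derivative. -/
def dx : BOp →+ BOp := map R.dxHom

theorem dx_apply (a : BOp) (k : ℤ) : (dx a).1 k = R.dx (a.1 k) := rfl

theorem dx_mul (a b : BOp) : dx (a * b) = dx a * b + a * dx b :=
  map_mul_of_derivation R.dxHom_sh R.dxHom_mul a b

theorem dx_const (a : R) : dx (const a) = const (R.dx a) := by
  refine ext fun k => ?_
  rw [dx_apply, const_apply, const_apply]
  split_ifs
  · rfl
  · exact map_zero R.dxHom

/-- The coefficientwise Gâteaux derivative. -/
def gat (g : F) : BOp →+ BOp := map (R.gatHom g)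

theorem gat_apply (g : F) (a : BOp) (k : ℤ) :
    (gat g a).1 k = Unitization.inr (F.gat g (a.1 k).snd) := rfl

theorem gat_mul (g : F) (a b : BOp) : gat g (a * b) = gat g a * b + a * gat g b :=
  map_mul_of_derivation (R.gatHom_sh g) (R.gatHom_mul g) a b

theorem aug_gat (g : F) (a : BOp) : aug (gat g a) = 0 :=
  aug_eq_zero.2 fun _ => by rw [gat_apply, Unitization.fst_inr]

theorem gat_dx (g : F) (a : BOp) : gat g (dx a) = dx (gat g a) :=
  ext fun k => by
    rw [gat_apply, dx_apply, dx_apply, gat_apply, R.snd_dx, F.gat_dx, R.dx_inr]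

/-- The part of nonnegative order. -/
def plus (a : BOp) : BOp := ⟨a.1.plus, a.2.choose, fun k hk => by
  change (if 0 ≤ k then a.1 k else 0) = 0
  rw [a.2.choose_spec k hk, ite_self]⟩

theorem plus_apply (a : BOp) (k : ℤ) : (plus a).1 k = if 0 ≤ k then a.1 k else 0 := rfl

/-- The part of negative order. -/
def minus (a : BOp) : BOp := a - plus a

theorem minus_apply (a : BOp) (k : ℤ) : (minus a).1 k = if 0 ≤ k then 0 else a.1 k := by
  rw [minus, sub_apply, plus_apply]
  split_ifs <;> simp

end BOp

open BOp

/-! ### The covariant derivative -/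

/-- The operator `A₁`. -/
def bA (h : ℝ) : BOp := ⟨opA h 1, 1, fun k hk => by
  rw [opA_one_apply, if_neg (by omega), if_neg (by omega)]⟩

/-- The Lax operator. -/
def bL (h : ℝ) : BOp := ⟨lax h, 1, fun k hk => by
  rw [lax, if_neg (by omega), if_neg (by omega), if_neg (by omega)]⟩

/-- The covariant derivative `∂ - [A₁, ·]`. -/
def cov (h : ℝ) : BOp →+ BOp where
  toFun a := dx a - (bA h * a - a * bA h)
  map_zero' := by simp
  map_add' a b := by rw [map_add, mul_add, add_mul]; abel

theorem cov_def (h : ℝ) (a : BOp) : cov h a = dx a - (bA h * a - a * bA h) := rfl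

/-- Only the last term involves another order: at order `k` one sees `Δ` of the coefficient of order
`k - 1`. This triangular shape is what allows solving from the top order downwards. -/
theorem cov_apply (h : ℝ) (a : BOp) (k : ℤ) :
    (cov h a).1 k = R.dx (a.1 k) -
      a.1 k * (Unitization.inr F.u - (R.sh ^ k) (Unitization.inr F.u)) -
      cst h⁻¹ * (R.sh (a.1 (k - 1)) - a.1 (k - 1)) := by
  rw [cov_def, sub_apply, sub_apply, dx_apply, coe_mul, coe_mul]
  change _ - ((opA h 1 * a.1) k - (a.1 * opA h 1) k) = _
  rw [opA_mul, mul_opA]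
  ring

theorem cov_mul (h : ℝ) (a b : BOp) : cov h (a * b) = cov h a * b + a * cov h b := by
  simp only [cov_def, dx_mul]
  noncomm_ring

theorem cov_lie (h : ℝ) (a b : BOp) :
    cov h (a * b - b * a) = (cov h a * b - b * cov h a) + (a * cov h b - cov h b * a) := by
  rw [map_sub, cov_mul, cov_mul]
  abel

theorem cov_bL {h : ℝ} (hh : h ≠ 0) : cov h (bL h) = 0 := by
  rw [cov_def, sub_eq_zero]
  exact Subtype.ext (lax_dx h hh)

theorem gat_bA (h : ℝ) (g : F) : gat g (bA h) = const (Unitization.inr g) := by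
  refine ext fun k => ?_
  rw [gat_apply, const_apply]
  change Unitization.inr (F.gat g (opA h 1 k).snd) = _
  rw [opA_one_apply]
  by_cases h1 : k = 1
  · subst h1; simp [cst]
  · rw [if_neg h1]
    split_ifs
    · have : F.gat g F.u = g := rfl
      simp [cst, this, R.snd_sub]
    · simp

/-- Varying `u` by `g` changes the connection `A₁` by multiplication by `g`, and this is the only
obstruction to commuting. -/
theorem cov_gat (h : ℝ) (g : F) (a : BOp) : cov h (gat g a) =
    gat g (cov h a) + (const (Unitization.inr g) * a - a * const (Unitization.inr g)) := by
  simp only [cov_def, map_sub, gat_mul, gat_dx, gat_bA]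
  abel

/-! ### Uniqueness and existence for the covariant derivative -/

theorem F.sh_eq_self {f : F} (e : F.sh f = f) : f = 0 := by
  rw [← F.delInv_del f, e, sub_self, F.delInv_zero]

theorem cst_inv_mul_cst {h : ℝ} (hh : h ≠ 0) : cst h * cst h⁻¹ = 1 := by
  rw [cst, cst, ← Unitization.inl_mul, ← map_mul, mul_inv_cancel₀ hh]; rfl

/-- Downward induction on the order: once all higher coefficients vanish, the next one is shift
invariant, and a shift invariant element of `F` is zero. Its polynomial part is excluded by the
value at `u = 0`. -/
theorem eq_zero_of_cov_apply {h : ℝ} (hh : h ≠ 0) {a : BOp} (ha : aug a = 0) {n : ℤ}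
    (hc : ∀ k, n < k → (cov h a).1 k = 0) (k : ℤ) (hk : n ≤ k) : a.1 k = 0 := by
  rw [aug_eq_zero] at ha
  obtain ⟨N, hN⟩ := a.2
  have key : ∀ i : ℕ, ∀ k, n ≤ k → N - i < k → a.1 k = 0 := by
    intro i
    induction i with
    | zero => exact fun k _ hk => hN k (by simpa using hk)
    | succ i ih =>
      intro k hk hk'
      -- The coefficient of order `k` is controlled by the equation of order `k + 1`; hence orders
      -- above `n` in the equation suffice for orders from `n` on in `a`.
      have e := hc (k + 1) (by omega)
      have dx0 : R.dx 0 = 0 := map_zero R.dxHom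
      rw [cov_apply, ih (k + 1) (by omega) (by push_cast at hk'; omega), dx0, zero_mul, sub_zero,
        zero_sub, neg_eq_zero, add_sub_cancel_right] at e
      have e2 : R.sh (a.1 k) = a.1 k := by
        rw [← sub_eq_zero, ← one_mul (R.sh (a.1 k) - a.1 k), ← cst_inv_mul_cst hh, mul_assoc, e,
          mul_zero]
      refine Unitization.ext (ha k) (F.sh_eq_self ?_)
      rw [← R.snd_sh, e2]
  exact key ((N - k).toNat + 1) k hk (by omega)

theorem eq_zero_of_cov {h : ℝ} (hh : h ≠ 0) {a : BOp} (ha : aug a = 0) (hc : cov h a = 0) :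
    a = 0 :=
  ext fun k => eq_zero_of_cov_apply hh ha (n := k) (fun j _ => by rw [hc]; rfl) k le_rfl

/-- The coefficients of a solution of the flatness equation of negative order. -/
def negCoeff (h : ℝ) (f : F) : ℕ → F
  | 0 => f
  | i + 1 => h • F.delInv
      (F.dx (negCoeff h f i) - negCoeff h f i * (F.u - F.shInv^[i + 1] F.u))

/-- The operator `f E⁻¹ + ⋯` whose covariant derivative has order zero. -/
def negOp (h : ℝ) (f : F) : BOp :=
  ⟨fun k => if k < 0 then Unitization.inr (negCoeff h f (-k - 1).toNat) else 0, 0,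
    fun _ hk => if_neg (by omega)⟩

theorem negOp_apply (h : ℝ) (f : F) (k : ℤ) : (negOp h f).1 k =
    if k < 0 then Unitization.inr (negCoeff h f (-k - 1).toNat) else 0 := rfl

theorem aug_negOp (h : ℝ) (f : F) : aug (negOp h f) = 0 :=
  aug_eq_zero.2 fun k => by rw [negOp_apply]; split_ifs <;> simp

/-- The recursive choice of coefficients cancels all negative orders. At order zero nothing is
available to cancel `Δ f`, which survives. -/
theorem cov_negOp {h : ℝ} (hh : h ≠ 0) (f : F) :
    cov h (negOp h f) = const (Unitization.inr (-(h⁻¹ • (F.sh f - f)))) := by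
  refine ext fun k => ?_
  have dx0 : R.dx 0 = 0 := map_zero R.dxHom
  rw [cov_apply, const_apply, negOp_apply, negOp_apply]
  rcases lt_trichotomy k 0 with hk | rfl | hk
  · obtain ⟨i, rfl⟩ : ∃ i : ℕ, k = -((i + 1 : ℕ) : ℤ) := ⟨(-k - 1).toNat, by omega⟩
    have e1 : (- -((i + 1 : ℕ) : ℤ) - 1).toNat = i := by omega
    have e2 : (-(-((i + 1 : ℕ) : ℤ) - 1) - 1).toNat = i + 1 := by omega
    rw [if_pos hk, if_pos (by omega), if_neg hk.ne, e1, e2, R.dx_inr, R.sh_zpow_neg_inr, R.sh_inr,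
      ← inr_sub', ← inr_sub', ← inr_mul', ← inr_sub', cst_mul_inr, ← inr_sub', negCoeff,
      F.sh_rsmul, ← smul_sub, F.del_delInv, smul_smul, inv_mul_cancel₀ hh, one_smul, sub_self,
      Unitization.inr_zero]
  · rw [if_neg (lt_irrefl 0), if_pos (by omega), if_pos rfl, dx0, zero_mul, sub_zero, zero_sub,
      R.sh_inr, ← inr_sub', cst_mul_inr, ← Unitization.inr_neg]
    rfl
  · rw [if_neg (by omega), if_neg (by omega), if_neg (by omega), dx0]
    simp

/-- The variation of the dressing operator in the direction `g`. -/
def dress (h : ℝ) (g : F) : BOp := negOp h (-(h • F.delInv g))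

theorem aug_dress (h : ℝ) (g : F) : aug (dress h g) = 0 := aug_negOp _ _

/-- The leading coefficient `-h Δ⁻¹ g` is chosen so that the surviving term of order zero is exactly
`g`. -/
theorem cov_dress {h : ℝ} (hh : h ≠ 0) (g : F) :
    cov h (dress h g) = const (Unitization.inr g) := by
  have e : F.sh (-(h • F.delInv g)) - -(h • F.delInv g) = -(h • g) := by
    rw [F.sh_neg, F.sh_rsmul, ← neg_sub', ← smul_sub, F.del_delInv]
  rw [dress, cov_negOp hh, e, smul_neg, neg_neg, smul_smul, inv_mul_cancel₀ hh, one_smul]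

/-! ### The algebra of flat operators -/

/-- The covariantly constant operators which at `u = 0` are difference operators. -/
def flat (h : ℝ) : Subring BOp where
  carrier := {a | cov h a = 0 ∧ ∀ k < 0, (a.1 k).fst = 0}
  zero_mem' := ⟨map_zero _, fun _ _ => rfl⟩
  one_mem' := by
    refine ⟨?_, fun k hk => ?_⟩
    · have e := cov_mul h 1 1
      simpa using e
    · rw [coe_one]
      change (if k = 0 then (1 : R) else 0).fst = 0
      rw [if_neg hk.ne]; rfl
  add_mem' := fun {a b} ha hb => ⟨by rw [map_add, ha.1, hb.1, add_zero], fun k hk => by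
    rw [BOp.add_apply, Unitization.fst_add, ha.2 k hk, hb.2 k hk, add_zero]⟩
  neg_mem' := fun {a} ha => ⟨by rw [map_neg, ha.1, neg_zero], fun k hk => by
    rw [BOp.neg_apply, Unitization.fst_neg, ha.2 k hk, neg_zero]⟩
  mul_mem' := fun {a b} ha hb => ⟨by rw [cov_mul, ha.1, hb.1, zero_mul, mul_zero, add_zero],
    fun k hk => by
      obtain ⟨A, hA⟩ := a.2
      obtain ⟨B, hB⟩ := b.2
      rw [coe_mul, Op.mul_apply_eq_sum hA hB k 0 le_rfl le_rfl, R.fst_sum]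
      refine Finset.sum_eq_zero fun j _ => ?_
      rw [Unitization.fst_mul, sub_zero]
      -- The orders `j` and `k - j` add up to a negative number, so one of them is negative and that
      -- factor vanishes at `u = 0`.
      rcases lt_or_ge j 0 with hj | hj
      · rw [ha.2 j hj, zero_mul]
      · have e : R.augHom ((R.sh ^ j) (b.1 (k - j))) = 0 := by
          rw [map_sh_zpow R.augHom_sh]
          change (R.sh ^ j) (Unitization.inl (b.1 (k - j)).fst) = 0
          rw [hb.2 _ (by omega), Unitization.inl_zero, map_zero]
        have e2 := congrArg (fun r : R => r.fst) e
        change ((R.sh ^ j) (b.1 (k - j))).fst = 0 at e2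
        rw [e2, mul_zero]⟩

theorem bL_mem_flat {h : ℝ} (hh : h ≠ 0) : bL h ∈ flat h :=
  ⟨cov_bL hh, fun k hk => by
    change (lax h k).fst = 0
    rw [lax, if_neg (by omega), if_neg (by omega), if_pos hk, Unitization.fst_inr]⟩

theorem const_cst_mem_flat (h c : ℝ) : const (cst c) ∈ flat h :=
  ⟨by rw [cov_def, dx_const, R.dx_cst, map_zero, const_cst_comm, sub_self, sub_zero],
    fun k hk => by rw [const_apply, if_neg hk.ne]; rfl⟩

/-! ### The Orlov-Schulman operator and its commutator with the Lax operator -/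

/-- The part of nonnegative order of the Orlov-Schulman operator. -/
def bM0 (h : ℝ) : BOp := const (Unitization.inl varX) * E +
  const (Unitization.inl (MvPolynomial.C h * varN) + Unitization.inr ((MvPolynomial.C h * varX) • F.u))

/-- The Orlov-Schulman operator `M = x E + h n + ⋯` with `M_x = [A₁, M]`. -/
def bM (h : ℝ) : BOp :=
  bM0 h + negOp h (h • F.delInv (F.dx ((MvPolynomial.C h * varX) • F.u)))

theorem bM0_apply (h : ℝ) (k : ℤ) : (bM0 h).1 k = if k = 1 then Unitization.inl varX else
    if k = 0 then Unitization.inl (MvPolynomial.C h * varN) +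
      Unitization.inr ((MvPolynomial.C h * varX) • F.u) else 0 := by
  rw [bM0, add_apply, const_mul_apply, E_apply, const_apply]
  by_cases h1 : k = 1
  · subst h1; simp
  · simp [h1]

theorem inl_mul_inr' (p : P) (f : F) :
    (Unitization.inl p * Unitization.inr f : R) = Unitization.inr (p • f) :=
  Unitization.inl_mul_inr p f

/-- At order one, `∂ x = 1` cancels against `h⁻¹ Δ(h n)`, and the commutator of `x E` with `u`
against `h⁻¹ Δ(h x u)`; this dictates the term `h x u`. Only order zero remains. -/
theorem cov_bM0 {h : ℝ} (hh : h ≠ 0) : cov h (bM0 h) =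
    const (Unitization.inr (F.dx ((MvPolynomial.C h * varX) • F.u))) := by
  refine ext fun k => ?_
  have dx0 : R.dx 0 = 0 := map_zero R.dxHom
  have dX : R.dx (Unitization.inl varX) = 1 := by
    refine Unitization.ext ?_ ?_
    · simp [R.fst_dx, dP, varX]
    · simp [R.snd_dx, F.dx_zero]
  have shX : R.sh (Unitization.inl varX) = Unitization.inl varX := by
    refine Unitization.ext ?_ ?_
    · simp [R.fst_sh, shP, varX]
    · simp [R.snd_sh, F.sh_zero]
  have shN : R.sh (Unitization.inl (MvPolynomial.C h * varN)) =
      Unitization.inl (MvPolynomial.C h * varN) + cst h := by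
    refine Unitization.ext ?_ ?_
    · simp [R.fst_sh, shP, varN, cst, mul_add]
    · simp [R.snd_sh, F.sh_zero, cst]
  have dN : R.dx (Unitization.inl (MvPolynomial.C h * varN)) = 0 := by
    refine Unitization.ext ?_ ?_
    · simp [R.fst_dx, dP, varN, MvPolynomial.pderiv_X]
    · simp [R.snd_dx, F.dx_zero]
  have sU : R.sh (Unitization.inr ((MvPolynomial.C h * varX) • F.u)) =
      cst h * Unitization.inl varX * R.sh (Unitization.inr F.u) := by
    rw [R.sh_inr, R.sh_inr, F.sh_smul, cst, ← Unitization.inl_mul, inl_mul_inr']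
    simp [shP, varX]
  have eU : (Unitization.inr ((MvPolynomial.C h * varX) • F.u) : R) =
      cst h * Unitization.inl varX * Unitization.inr F.u := by
    rw [cst, ← Unitization.inl_mul, inl_mul_inr']
  have hc := cst_inv_mul_cst hh
  rw [cov_apply, const_apply, bM0_apply, bM0_apply]
  by_cases h2 : k = 2
  · subst h2
    simp [dx0, shX]
  by_cases h1 : k = 1
  · subst h1
    simp only [if_true, sub_self, if_neg (show (0 : ℤ) ≠ 1 by omega), if_neg (show (1 : ℤ) ≠ 0 by omega),
      map_add, shN, sU, dX, zpow_one]
    rw [eU]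
    linear_combination (-1 - Unitization.inl varX * (R.sh (Unitization.inr F.u) -
      Unitization.inr F.u)) * hc
  by_cases h0 : k = 0
  · subst h0
    have e : R.sh 0 = 0 := map_zero R.sh
    simp only [zero_ne_one, if_false, if_true, zpow_zero, RingAut.one_apply, sub_self, mul_zero,
      sub_zero, R.dx_add, dN, zero_add, R.dx_inr]
    rw [if_neg (by omega), if_neg (by omega), e]
    simp
  · rw [if_neg h1, if_neg h0, if_neg (by omega), if_neg (by omega), if_neg h0, dx0]
    simp

/-- The negative tail of `M` is the solution whose covariant derivative cancels the order-zero
defect of `bM0`. -/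
theorem bM_mem_flat {h : ℝ} (hh : h ≠ 0) : bM h ∈ flat h := by
  refine ⟨?_, fun k hk => ?_⟩
  · rw [bM, map_add, cov_bM0 hh, cov_negOp hh, ← map_add, ← Unitization.inr_add, F.sh_rsmul,
      ← smul_sub, F.del_delInv, smul_smul, inv_mul_cancel₀ hh, one_smul, add_neg_cancel,
      Unitization.inr_zero, map_zero]
  · rw [bM, add_apply, Unitization.fst_add, aug_eq_zero.1 (aug_negOp _ _), add_zero, bM0_apply,
      if_neg (by omega), if_neg (by omega), Unitization.fst_zero]

theorem aug_bL (h : ℝ) : aug (bL h) = const (cst h⁻¹) * (E - 1) := by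
  refine ext fun k => ?_
  rw [aug_apply, const_mul_apply, sub_apply, E_apply, coe_one]
  change Unitization.inl (lax h k).fst = cst h⁻¹ * (_ - if k = 0 then 1 else 0)
  rw [lax]
  by_cases h1 : k = 1
  · subst h1; simp [cst]
  by_cases h0 : k = 0
  · subst h0; simp [cst, R.fst_sub]
  · by_cases hk : k < 0 <;> simp [h1, h0, hk]

theorem aug_bM (h : ℝ) : aug (bM h) = const (Unitization.inl varX) * E +
    const (Unitization.inl (MvPolynomial.C h * varN)) := by
  have eE : aug E = E := by
    refine ext fun k => ?_
    rw [aug_apply, E_apply]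
    split_ifs <;> simp
  rw [bM, bM0, map_add, aug_negOp, add_zero, map_add, map_mul, eE, aug_const, aug_const]
  simp

/-- Both sides are flat, so it suffices to compare them at `u = 0`. There `L` is `h⁻¹ (E - 1)` and
`M` is `x E + h n`; as `E` commutes with `x` and `E n = (n + 1) E`, both sides equal `E`. -/
theorem lie_bL_bM {h : ℝ} (hh : h ≠ 0) :
    bL h * bM h - bM h * bL h = 1 + const (cst h) * bL h := by
  have hL := bL_mem_flat hh
  have hM := bM_mem_flat hh
  rw [← sub_eq_zero]
  refine eq_zero_of_cov hh ?_ ((flat h).sub_mem ((flat h).sub_mem ((flat h).mul_mem hL hM)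
    ((flat h).mul_mem hM hL)) ((flat h).add_mem (flat h).one_mem
      ((flat h).mul_mem (const_cst_mem_flat h h) hL))).1
  have hc : const (cst h) * const (cst h⁻¹) = 1 := by
    rw [← map_mul, cst_inv_mul_cst hh, map_one]
  have shX : E * const (Unitization.inl varX) = const (Unitization.inl varX) * E := by
    rw [E_mul_const]
    congr 2
    refine Unitization.ext ?_ ?_
    · simp [R.fst_sh, shP, varX]
    · simp [R.snd_sh, F.sh_zero]
  have shN : E * const (Unitization.inl (MvPolynomial.C h * varN)) =
      const (Unitization.inl (MvPolynomial.C h * varN)) * E + const (cst h) * E := by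
    rw [E_mul_const, ← add_mul, ← map_add]
    congr 2
    refine Unitization.ext ?_ ?_
    · simp [R.fst_sh, shP, varN, cst, mul_add]
    · simp [R.snd_sh, F.sh_zero, cst]
  have ea : aug (const (cst h)) = const (cst h) := aug_const _
  rw [map_sub, map_sub, map_add, map_mul, map_mul, map_mul, map_one, aug_bL, aug_bM, ea,
    ← mul_assoc (const (cst h)), hc, one_mul]
  set X := const (Unitization.inl varX)
  set N := const (Unitization.inl (MvPolynomial.C h * varN))
  set K := const (cst h⁻¹) with hK
  set H := const (cst h) with hH
  have cK : ∀ a, a * K = K * a := fun a => (const_cst_comm _ a).symm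
  have e : K * (E - 1) * (X * E + N) - (X * E + N) * (K * (E - 1)) =
      K * ((E * X - X * E) * E + (E * N - N * E)) := by
    rw [← mul_assoc (X * E + N), cK]
    noncomm_ring
  rw [e, shX, shN, sub_self, zero_mul, zero_add, add_sub_cancel_left, ← mul_assoc, ← cK, hc,
    one_mul]
  abel

/-! ### Flows of flat operators -/

/-- The coefficient of `E⁰`, up to its value at `u = 0`. -/
def omega : BOp →+ F where
  toFun a := (a.1 0).snd
  map_zero' := rfl
  map_add' _ _ := rfl

theorem omega_apply (a : BOp) : omega a = (a.1 0).snd := rfl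

theorem omega_const_cst_mul (c : ℝ) (a : BOp) : omega (const (cst c) * a) = c • omega a := by
  rw [omega_apply, const_mul_apply, cst, Unitization.snd_mul, Unitization.snd_inl,
    Unitization.fst_inl, smul_zero, zero_mul, add_zero, add_zero]
  rfl

theorem gat_omega (g : F) (a : BOp) : F.gat g (omega a) = omega (gat g a) := by
  rw [omega_apply, omega_apply, gat_apply, Unitization.snd_inr]

theorem minus_mul_minus_apply_zero (a b : BOp) : (minus a * minus b).1 0 = 0 :=
  Op.mul_eq_zero_of_lt (N := -1) (M := -1) (fun k hk => by rw [minus_apply, if_pos (by omega)])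
    (fun k hk => by rw [minus_apply, if_pos (by omega)]) 0 (by omega)

theorem plus_mul_plus_apply_zero (a b : BOp) : (plus a * plus b).1 0 = a.1 0 * b.1 0 := by
  rw [coe_mul, Op.mul_apply, finsum_eq_single _ 0]
  · simp [plus_apply]
  · intro j hj
    rw [plus_apply, plus_apply]
    split_ifs
    · omega
    · rw [map_zero, mul_zero]
    · rw [zero_mul]
    · rw [zero_mul]

section Flat

variable {h : ℝ} {D D' : BOp}

theorem aug_minus (hD : D ∈ flat h) : aug (minus D) = 0 :=
  aug_eq_zero.2 fun k => by
    rw [minus_apply]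
    split_ifs with hk
    · rfl
    · exact hD.2 k (by omega)

/-- Truncation disturbs flatness only at order zero, where the `Δ` of the coefficient of `E⁻¹` is
cut off and `∂` of the coefficient of `E⁰` is left. Flatness equates the two, and the former
vanishes at `u = 0`. -/
theorem cov_plus (hD : D ∈ flat h) :
    cov h (plus D) = const (Unitization.inr (F.dx (omega D))) := by
  refine ext fun k => ?_
  have dx0 : R.dx 0 = 0 := map_zero R.dxHom
  have e := cov_apply h D k
  rw [hD.1, zero_apply] at e
  rw [cov_apply, const_apply, plus_apply, plus_apply]
  rcases lt_trichotomy k 0 with hk | rfl | hk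
  · rw [if_neg (by omega), if_neg (by omega), if_neg hk.ne, dx0]
    simp
  · rw [if_pos le_rfl, if_neg (by omega), if_pos rfl]
    simp only [zpow_zero, RingAut.one_apply, sub_self, mul_zero, sub_zero, map_zero] at e ⊢
    refine Unitization.ext ?_ (by rw [R.snd_dx, Unitization.snd_inr, omega_apply])
    have e2 := congrArg (fun r : R => r.fst) (sub_eq_zero.1 e.symm)
    rw [show (R.dx (D.1 0)).fst = _ from e2, Unitization.fst_inr, Unitization.fst_mul, R.fst_sub,
      R.fst_sh, hD.2 _ (by omega),
      map_zero, sub_zero, mul_zero]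
  · rw [if_pos hk.le, if_pos (by omega), if_neg hk.ne', ← e]

theorem cov_minus (hD : D ∈ flat h) :
    cov h (minus D) = -const (Unitization.inr (F.dx (omega D))) := by
  rw [minus, map_sub, hD.1, cov_plus hD, zero_sub]

/-- Both sides vanish at `u = 0` and both have covariant derivative `[g, D]`, so uniqueness applies.
Every flat operator thus varies by conjugation with one and the same `S`. -/
theorem gat_flat (hh : h ≠ 0) (hD : D ∈ flat h) {S : BOp} {g : F} (hS : aug S = 0)
    (hc : cov h S = const (Unitization.inr g)) : gat g D = S * D - D * S := by
  rw [← sub_eq_zero]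
  refine eq_zero_of_cov hh ?_ ?_
  · rw [map_sub, aug_gat, map_sub, map_mul, map_mul, hS, zero_mul, mul_zero, sub_self, sub_self]
  · rw [map_sub, cov_gat, hD.1, map_zero, cov_lie, hc, hD.1, mul_zero, zero_mul]
    abel

/-- For the direction `∂ω(D)` the operator `-D₋` is such an `S`, because `D₊` and `D₋` have opposite
covariant derivatives. -/
theorem gat_flow (hh : h ≠ 0) (hD : D ∈ flat h) (hD' : D' ∈ flat h) :
    gat (F.dx (omega D)) D' = D' * minus D - minus D * D' := by
  rw [gat_flat hh hD' (S := -minus D) (by rw [map_neg, aug_minus hD, neg_zero])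
    (by rw [map_neg, cov_minus hD, neg_neg])]
  noncomm_ring

/-- After splitting into positive and negative parts, the two sides differ by `[D'₋, D₋] - [D'₊,
D₊]`. The first commutator has order below zero. In the second, order zero comes only from the
product of the two order-zero coefficients, which commute. -/
theorem gat_omega_sub (hh : h ≠ 0) (hD : D ∈ flat h) (hD' : D' ∈ flat h) :
    F.gat (F.dx (omega D)) (omega D') - F.gat (F.dx (omega D')) (omega D) =
      omega (D' * D - D * D') := by
  rw [gat_omega, gat_omega, gat_flow hh hD hD', gat_flow hh hD' hD, ← map_sub, ← sub_eq_zero,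
    ← map_sub]
  have e : D' * minus D - minus D * D' - (D * minus D' - minus D' * D) - (D' * D - D * D') =
      (minus D' * minus D - minus D * minus D') - (plus D' * plus D - plus D * plus D') := by
    rw [minus, minus]
    noncomm_ring
  rw [e, omega_apply, BOp.sub_apply, BOp.sub_apply, BOp.sub_apply, minus_mul_minus_apply_zero,
    minus_mul_minus_apply_zero, plus_mul_plus_apply_zero, plus_mul_plus_apply_zero,
    mul_comm (D.1 0), sub_self, sub_self, sub_self, Unitization.snd_zero]

end Flat

/-! ### The generators -/

theorem order_pow_bL (h : ℝ) (m : ℕ) (k : ℤ) (hk : m < k) : (bL h ^ m).1 k = 0 := by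
  induction m generalizing k with
  | zero => exact if_neg (by simpa using hk.ne')
  | succ m ih =>
    rw [pow_succ', coe_mul]
    exact Op.mul_eq_zero_of_lt (N := 1) (M := m)
      (fun j hj => by
        change lax h j = 0
        rw [lax, if_neg (by omega), if_neg (by omega), if_neg (by omega)])
      (fun j hj => ih j hj) k (by push_cast at hk; omega)

theorem order_bM (h : ℝ) (k : ℤ) (hk : 1 < k) : (bM h).1 k = 0 := by
  rw [bM, BOp.add_apply, bM0_apply, negOp_apply, if_neg (by omega), if_neg (by omega),
    if_neg (by omega), add_zero]

/-- The generators `M L^j` of the non-isospectral flows. -/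
def bN (h : ℝ) (j : ℕ) : BOp := bM h * bL h ^ j

theorem zcA_eq_cov (h : ℝ) (m : ℕ) : zcA h m = (cov h (plus (bL h ^ m))).1 := by
  change (opA h m).dx - (opA h 1).comm (opA h m) = _
  have e : opA h m = (plus (bL h ^ m)).1 := by
    rw [opA, ← show (bL h ^ m).1 = (lax h).npow m from coe_pow _ _]; rfl
  rw [e]
  rfl

/-- The prescribed asymptotics is the rewriting `x E + h n = x Δ + (x + h n)` of `M` at `u = 0`,
multiplied by `(h⁻¹ Δ)^m`; hence index `m + 1` belongs to `M L^m`. -/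
theorem asymB_eq (h : ℝ) (m : ℕ) : asymB h (m + 1) = (aug (bN h m)).1 := by
  have eD : (E - 1 : BOp).1 = Op.del := by
    funext k
    rw [BOp.sub_apply, E_apply, coe_one]
    change _ - (if k = 0 then 1 else 0) = if k = 1 then 1 else if k = 0 then -1 else 0
    split_ifs <;> first | omega | simp
  have eK : ∀ p : P, (Unitization.inl (MvPolynomial.C (h⁻¹ ^ m) * p) : R) =
      cst h⁻¹ ^ m * Unitization.inl p := fun p => by
    rw [Unitization.inl_mul]
    congr 1
    induction m with
    | zero => simp
    | succ m ih => rw [pow_succ, map_mul, Unitization.inl_mul, ih, pow_succ]; rfl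
  have e : aug (bN h m) =
      const (Unitization.inl (MvPolynomial.C (h⁻¹ ^ m) * varX)) * (E - 1) ^ (m + 1) +
      const (Unitization.inl (MvPolynomial.C (h⁻¹ ^ m) * (varX + MvPolynomial.C h * varN))) *
        (E - 1) ^ m := by
    have hc : Commute (const (cst h⁻¹)) (E - 1) := const_cst_comm _ _
    have hc' : (aug (bM h)) * const (cst h⁻¹) ^ m = const (cst h⁻¹) ^ m * aug (bM h) :=
      ((show Commute (const (cst h⁻¹)) (aug (bM h)) from const_cst_comm _ _).pow_left m).symm
    rw [bN, map_mul, map_pow, aug_bL, hc.mul_pow, ← mul_assoc, hc', aug_bM, eK, eK, map_mul,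
      map_mul, map_pow, Unitization.inl_add, map_add, pow_succ']
    noncomm_ring
  rw [e]
  change Op.const _ * _ + Op.const _ * _ = Op.const _ * ((E - 1 : BOp) ^ (m + 1)).1 +
    Op.const _ * ((E - 1 : BOp) ^ m).1
  rw [coe_pow, coe_pow, eD]
  rfl

section Generators

variable {h : ℝ} (hh : h ≠ 0)
include hh

theorem pow_bL_mem_flat (m : ℕ) : bL h ^ m ∈ flat h := (flat h).pow_mem (bL_mem_flat hh) m

theorem bN_mem_flat (m : ℕ) : bN h m ∈ flat h :=
  (flat h).mul_mem (bM_mem_flat hh) (pow_bL_mem_flat hh m)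

/-- Leibniz rule and induction from `[L, M] = 1 + h L`, the constant `h` being central. -/
theorem lie_pow_bL_bM (k : ℕ) : bL h ^ k * bM h - bM h * bL h ^ k =
    k • (const (cst h) * bL h ^ k + bL h ^ (k - 1)) := by
  induction k with
  | zero => simp
  | succ k ih =>
    have e : bL h ^ (k + 1) * bM h - bM h * bL h ^ (k + 1) =
        bL h * (bL h ^ k * bM h - bM h * bL h ^ k) + (bL h * bM h - bM h * bL h) * bL h ^ k := by
      rw [pow_succ']
      noncomm_ring
    -- The factor `k` makes the truncated exponent `k - 1` harmless at `k = 0`.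
    have e2 : k • (bL h * bL h ^ (k - 1)) = k • bL h ^ k := by
      rcases k with _ | k
      · simp
      · rw [Nat.add_sub_cancel, pow_succ']
    rw [e, ih, lie_bL_bM hh, mul_smul_comm, mul_add, smul_add, e2, ← mul_assoc, ← const_cst_comm,
      mul_assoc, ← pow_succ', Nat.add_sub_cancel, add_mul, one_mul, mul_assoc, ← pow_succ',
      add_smul, one_smul, smul_add]
    abel

theorem lie_pow_bL_bN (l j : ℕ) : bL h ^ l * bN h j - bN h j * bL h ^ l =
    l • (const (cst h) * bL h ^ (l + j) + bL h ^ (l + j - 1)) := by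
  have e : bL h ^ l * bN h j - bN h j * bL h ^ l =
      (bL h ^ l * bM h - bM h * bL h ^ l) * bL h ^ j := by
    rw [bN, mul_assoc (bM h), ← pow_add, add_comm j, pow_add]
    noncomm_ring
  rw [e, lie_pow_bL_bM hh, smul_mul_assoc]
  rcases l with _ | l
  · simp
  · rw [add_mul, mul_assoc, ← pow_add, ← pow_add]
    congr 4
    omega

/-- Since powers of `L` commute, this commutator is `M ([L^i, M L^j] - [L^j, M L^i])`, and both
inner commutators are known. -/
theorem lie_bN_bN (i j : ℕ) : bN h i * bN h j - bN h j * bN h i =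
    ((i : ℤ) - j) • (const (cst h) * bN h (i + j) + bN h (i + j - 1)) := by
  have key : ∀ i j : ℕ, bM h * (bL h ^ i * bN h j - bN h j * bL h ^ i) =
      (i : ℤ) • (const (cst h) * bN h (i + j) + bN h (i + j - 1)) := fun i j => by
    rw [lie_pow_bL_bN hh, mul_smul_comm, mul_add, ← mul_assoc, ← const_cst_comm, mul_assoc,
      natCast_zsmul]
    rfl
  have e : bN h i * bN h j - bN h j * bN h i =
      bM h * (bL h ^ i * bN h j - bN h j * bL h ^ i) -
      bM h * (bL h ^ j * bN h i - bN h i * bL h ^ j) +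
      bM h * (bM h * (bL h ^ j * bL h ^ i - bL h ^ i * bL h ^ j)) := by
    simp only [bN]
    noncomm_ring
  rw [e, key, key, ← pow_add, ← pow_add, add_comm j i, sub_self, mul_zero, mul_zero, add_zero,
    ← sub_smul]

/-! ### The flows of the hierarchies -/

theorem flowK_eq (m : ℕ) : flowK h m = F.dx (omega (bL h ^ m)) := by
  rw [flowK, zcA_eq_cov, cov_plus (pow_bL_mem_flat hh m), const_apply, if_pos rfl,
    Unitization.snd_inr]

theorem zcA_eq (m : ℕ) : zcA h m = Op.const (Unitization.inr (flowK h m)) := by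
  rw [flowK_eq hh, zcA_eq_cov, cov_plus (pow_bL_mem_flat hh m)]; rfl

theorem gam_eq (m : ℕ) : gam h m = omega (bL h ^ m) := by rw [gam, flowK_eq hh, F.dxInv_dx]

/-- The Lax equation is `gat_flow` in disguise: `L` moves by `[L, (M L^m)₋]`, which is `[B, L] + [L,
M L^m]`, and the last commutator supplies the inhomogeneous terms `h L^(m+1) + L^m`. -/
theorem isNonisospectral (m : ℕ) :
    IsNonisospectral h (m + 1) (plus (bN h m)).1 (F.dx (omega (bN h m))) where
  order k hk := by
    rw [plus_apply]
    rcases hk with hk | hk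
    · rw [if_neg (by omega)]
    · rw [if_pos (by omega), bN, coe_mul]
      exact Op.mul_eq_zero_of_lt (N := 1) (M := m) (order_bM h) (order_pow_bL h m) k
        (by push_cast at hk; omega)
  asym k := by
    rw [asymB_eq, aug_apply, Unitization.fst_inl, plus_apply]
    split_ifs with hk
    · rfl
    · rw [(bN_mem_flat hh m).2 k (by omega), Unitization.fst_zero]
  compat := by
    have e := gat_flow hh (bN_mem_flat hh m) (bL_mem_flat hh)
    have e2 : bL h * bN h m - bN h m * bL h =
        const (cst h) * bL h ^ (m + 1) + bL h ^ m := by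
      have := lie_pow_bL_bN hh 1 m
      rwa [pow_one, one_smul, add_comm 1 m, Nat.add_sub_cancel] at this
    have e3 : gat (F.dx (omega (bN h m))) (bL h) =
        plus (bN h m) * bL h - bL h * plus (bN h m) + const (cst h) * bL h ^ (m + 1) +
          bL h ^ m := by
      rw [e, add_assoc, ← e2, minus]
      noncomm_ring
    have e4 := congrArg Subtype.val e3
    change (lax h).gat _ = (plus (bN h m)).1.comm (lax h) +
      Op.const (cst h) * (bL h ^ (m + 1)).1 + (bL h ^ m).1 at e4
    rwa [coe_pow, coe_pow] at e4
  zeroCurv := congrArg Subtype.val (cov_plus (bN_mem_flat hh m))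

/-- The difference of two candidates vanishes at `u = 0`, and its covariant derivative has order
zero only. This forces all coefficients of nonnegative order to vanish, and there are no others. -/
theorem IsNonisospectral.unique {m : ℕ} {B B' : Op} {σ σ' : F} (H : IsNonisospectral h m B σ)
    (H' : IsNonisospectral h m B' σ') : B = B' ∧ σ = σ' := by
  let b : BOp := ⟨B, m, fun k hk => H.order k (Or.inr hk)⟩
  let b' : BOp := ⟨B', m, fun k hk => H'.order k (Or.inr hk)⟩
  have hb : cov h b = const (Unitization.inr σ) := Subtype.ext H.zeroCurv
  have hb' : cov h b' = const (Unitization.inr σ') := Subtype.ext H'.zeroCurv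
  have ha : aug (b - b') = 0 := aug_eq_zero.2 fun k => by
    rw [BOp.sub_apply, R.fst_sub]
    change (B k).fst - (B' k).fst = 0
    rw [H.asym, H'.asym, sub_self]
  have e : b = b' := by
    refine ext fun k => ?_
    rcases lt_or_ge k 0 with hk | hk
    · exact (H.order k (Or.inl hk)).trans (H'.order k (Or.inl hk)).symm
    · rw [← sub_eq_zero, ← BOp.sub_apply]
      refine eq_zero_of_cov_apply hh ha (n := 0) (fun j hj => ?_) k hk
      rw [map_sub, hb, hb', BOp.sub_apply, const_apply, const_apply, if_neg hj.ne',
        if_neg hj.ne', sub_self]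
  refine ⟨congrArg Subtype.val e, ?_⟩
  rw [e, hb'] at hb
  have e2 := congrArg (fun a : BOp => (a.1 0).snd) hb
  simpa [const_apply] using e2.symm

theorem existsUnique_isNonisospectral (m : ℕ) (hm : 1 ≤ m) :
    ∃! q : Op × F, IsNonisospectral h m q.1 q.2 := by
  obtain ⟨m, rfl⟩ := Nat.exists_eq_add_of_le' hm
  refine ⟨(_, _), isNonisospectral hh m, fun q hq => ?_⟩
  exact Prod.ext_iff.2 (hq.unique hh (isNonisospectral hh m))

theorem flowS_eq (m : ℕ) : flowS h (m + 1) = F.dx (omega (bN h m)) :=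
  (IsNonisospectral.unique hh (Classical.epsilon_spec
    (p := fun q : Op × F => IsNonisospectral h (m + 1) q.1 q.2) ⟨(_, _), isNonisospectral hh m⟩)
    (isNonisospectral hh m)).2

theorem omg_eq (m : ℕ) : omg h (m + 1) = omega (bN h m) := by rw [omg, flowS_eq hh, F.dxInv_dx]

end Generators

/-! ### Functionals -/

/-- The functional `∑ₙ ∫ f g dx` as a bilinear map. -/
def sumIntL : F →ₗ[ℝ] F →ₗ[ℝ] V := (TensorProduct.mk ℝ F F).compr₂ partsRel.mkQ

theorem sumIntL_apply (f g : F) : sumIntL f g = sumInt f g := rfl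

theorem mkQ_eq_zero_of_rel {z : F ⊗[ℝ] F} (H : PartsRel z) : partsRel.mkQ z = 0 := by
  rw [Submodule.mkQ_apply, Submodule.Quotient.mk_eq_zero]
  exact Submodule.subset_span H

theorem sumInt_comm (f g : F) : sumInt f g = sumInt g f := by
  rw [← sub_eq_zero, sumInt, sumInt, ← map_sub]
  exact mkQ_eq_zero_of_rel (.comm f g)

theorem sumInt_mul_left (f g k : F) : sumInt (f * g) k = sumInt f (g * k) := by
  rw [← sub_eq_zero, sumInt, sumInt, ← map_sub]
  exact mkQ_eq_zero_of_rel (.assoc f g k)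

theorem sumInt_smul_left (p : P) (f g : F) : sumInt (p • f) g = sumInt f (p • g) := by
  rw [← sub_eq_zero, sumInt, sumInt, ← map_sub]
  exact mkQ_eq_zero_of_rel (.smul p f g)

theorem sumInt_dx_left (f g : F) : sumInt (F.dx f) g = -sumInt f (F.dx g) := by
  rw [eq_neg_iff_add_eq_zero, sumInt, sumInt, ← map_add]
  exact mkQ_eq_zero_of_rel (.dx f g)

theorem sumInt_sh (f g : F) : sumInt (F.sh f) (F.sh g) = sumInt f g := by
  rw [← sub_eq_zero, sumInt, sumInt, ← map_sub]
  exact mkQ_eq_zero_of_rel (.sh f g)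

theorem sumInt_add_left (f f' g : F) : sumInt (f + f') g = sumInt f g + sumInt f' g := by
  simp only [← sumIntL_apply, map_add, LinearMap.add_apply]

theorem sumInt_add_right (f g g' : F) : sumInt f (g + g') = sumInt f g + sumInt f g' := by
  simp only [← sumIntL_apply, map_add]

theorem sumInt_sub_left (f f' g : F) : sumInt (f - f') g = sumInt f g - sumInt f' g := by
  simp only [← sumIntL_apply, map_sub, LinearMap.sub_apply]

theorem sumInt_sub_right (f g g' : F) : sumInt f (g - g') = sumInt f g - sumInt f g' := by
  simp only [← sumIntL_apply, map_sub]

theorem sumInt_rsmul_left (r : ℝ) (f g : F) : sumInt (r • f) g = r • sumInt f g := by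
  simp only [← sumIntL_apply, map_smul, LinearMap.smul_apply]

theorem sumInt_rsmul_right (r : ℝ) (f g : F) : sumInt f (r • g) = r • sumInt f g := by
  simp only [← sumIntL_apply, map_smul]

theorem gatV_sumInt (g a b : F) :
    gatV g (sumInt a b) = sumInt (F.gat g a) b + sumInt a (F.gat g b) := by
  change partsRel.mkQ (gatT g (a ⊗ₜ b)) = _
  rw [gatT_tmul, map_add]
  rfl

theorem V.induction {C : V → Prop} (h0 : C 0) (hi : ∀ f g, C (sumInt f g))
    (ha : ∀ v w, C v → C w → C (v + w)) (v : V) : C v := by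
  obtain ⟨z, rfl⟩ := partsRel.mkQ_surjective v
  induction z using TensorProduct.induction_on with
  | zero => rwa [map_zero]
  | tmul f g => exact hi f g
  | add z w hz hw => rw [map_add]; exact ha _ _ hz hw

/-! ### The trace form -/

/-- The pairing `∑ₙ ∫ a b dx` of coefficients vanishing at `u = 0`. -/
def pairR (a b : R) : V := sumInt a.snd b.snd

theorem pairR_sum_left {ι : Type*} (s : Finset ι) (f : ι → R) (b : R) :
    pairR (∑ i ∈ s, f i) b = ∑ i ∈ s, pairR (f i) b := by
  simp only [pairR, R.snd_sum, ← sumIntL_apply, map_sum, LinearMap.sum_apply]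

theorem pairR_sum_right {ι : Type*} (s : Finset ι) (a : R) (f : ι → R) :
    pairR a (∑ i ∈ s, f i) = ∑ i ∈ s, pairR a (f i) := by
  simp only [pairR, R.snd_sum, ← sumIntL_apply, map_sum]

theorem pairR_comm (a b : R) : pairR a b = pairR b a := sumInt_comm _ _

theorem pairR_zero_left (b : R) : pairR 0 b = 0 := by
  simp [pairR, ← sumIntL_apply]

theorem pairR_zero_right (a : R) : pairR a 0 = 0 := by
  simp [pairR, ← sumIntL_apply]

/-- The pairing sees only parts in `F`. If `a` or `b` had a polynomial part, one side would acquire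
a term without counterpart; this is why cyclicity of the trace requires two factors vanishing at `u
= 0`, while the moved factor is arbitrary. -/
theorem pairR_mul_left {a b : R} (ha : a.fst = 0) (hb : b.fst = 0) (r : R) :
    pairR (a * r) b = pairR a (r * b) := by
  rw [pairR, pairR, Unitization.snd_mul, Unitization.snd_mul, ha, hb, zero_smul, zero_add,
    add_zero, sumInt_add_left, sumInt_add_right, sumInt_smul_left, sumInt_mul_left]

theorem pairR_sh_zpow (j : ℤ) (a b : R) :
    pairR ((R.sh ^ j) a) ((R.sh ^ j) b) = pairR a b := by
  have key : ∀ a b : R, pairR (R.sh a) (R.sh b) = pairR a b := fun a b => by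
    rw [pairR, R.snd_sh, R.snd_sh, sumInt_sh]; rfl
  induction j generalizing a b with
  | zero => rfl
  | succ i ih =>
    rw [zpow_add_one, RingAut.mul_apply, RingAut.mul_apply, ih, key]
  | pred i ih =>
    rw [zpow_sub_one, RingAut.mul_apply, RingAut.mul_apply, ih, ← key]
    change pairR (R.sh (R.sh.symm a)) (R.sh (R.sh.symm b)) = _
    rw [RingEquiv.apply_symm_apply, RingEquiv.apply_symm_apply]

theorem pairR_dx_left (a b : R) : pairR (R.dx a) b = -pairR a (R.dx b) := by
  rw [pairR, R.snd_dx, sumInt_dx_left, pairR, R.snd_dx]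

/-- The trace form `(a, b) ↦ ∑ₙ ∫ (a b)₀ dx`, where `(·)₀` is the coefficient of `E⁰`. -/
def tr (a b : BOp) : V := ∑ᶠ k : ℤ, pairR (a.1 k) ((R.sh ^ k) (b.1 (-k)))

theorem tr_eq_sum {a b : BOp} {N M : ℤ} (ha : ∀ k, N < k → a.1 k = 0)
    (hb : ∀ k, M < k → b.1 k = 0) {lo hi : ℤ} (hlo : lo ≤ -M) (hhi : N ≤ hi) :
    tr a b = ∑ k ∈ Finset.Icc lo hi, pairR (a.1 k) ((R.sh ^ k) (b.1 (-k))) := by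
  refine finsum_eq_sum_of_support_subset _ fun k hk => ?_
  simp only [Function.mem_support] at hk
  simp only [Finset.coe_Icc, Set.mem_Icc]
  constructor
  · by_contra hc
    exact hk (by rw [hb _ (by omega), map_zero, pairR_zero_right])
  · by_contra hc
    exact hk (by rw [ha _ (by omega), pairR_zero_left])

/-- Reflection `k ↦ -k` of the order combined with shift invariance of the sum over `n`. -/
theorem tr_comm (a b : BOp) : tr a b = tr b a := by
  rw [tr, tr, ← finsum_comp_equiv (Equiv.neg ℤ)]
  refine finsum_congr fun k => ?_
  rw [Equiv.neg_apply, neg_neg, pairR_comm (b.1 k), ← pairR_sh_zpow k, ← RingAut.mul_apply,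
    ← zpow_add, add_neg_cancel, zpow_zero, RingAut.one_apply]

theorem tr_add_left (a a' b : BOp) : tr (a + a') b = tr a b + tr a' b := by
  obtain ⟨N, hN⟩ := a.2
  obtain ⟨N', hN'⟩ := a'.2
  obtain ⟨M, hM⟩ := b.2
  have h1 : ∀ k, max N N' < k → a.1 k = 0 := fun k hk => hN k (by omega)
  have h2 : ∀ k, max N N' < k → a'.1 k = 0 := fun k hk => hN' k (by omega)
  have h3 : ∀ k, max N N' < k → (a + a').1 k = 0 := fun k hk => by
    rw [BOp.add_apply, h1 k hk, h2 k hk, add_zero]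
  rw [tr_eq_sum h1 hM le_rfl le_rfl, tr_eq_sum h2 hM le_rfl le_rfl, tr_eq_sum h3 hM le_rfl le_rfl,
    ← Finset.sum_add_distrib]
  refine Finset.sum_congr rfl fun k _ => ?_
  rw [BOp.add_apply, pairR, Unitization.snd_add, sumInt_add_left]
  rfl

theorem tr_add_right (a b b' : BOp) : tr a (b + b') = tr a b + tr a b' := by
  rw [tr_comm, tr_add_left, tr_comm b, tr_comm b']

theorem tr_neg_left (a b : BOp) : tr (-a) b = -tr a b := by
  have e := tr_add_left (-a) a b
  have e0 := tr_add_left 0 0 b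
  rw [add_zero, left_eq_add] at e0
  rw [neg_add_cancel, e0] at e
  exact eq_neg_of_add_eq_zero_left e.symm

theorem tr_neg_right (a b : BOp) : tr a (-b) = -tr a b := by
  rw [tr_comm, tr_neg_left, tr_comm]

theorem tr_sub_left (a a' b : BOp) : tr (a - a') b = tr a b - tr a' b := by
  rw [sub_eq_add_neg, tr_add_left, tr_neg_left, sub_eq_add_neg]

theorem tr_sub_right (a b b' : BOp) : tr a (b - b') = tr a b - tr a b' := by
  rw [sub_eq_add_neg, tr_add_right, tr_neg_right, sub_eq_add_neg]

theorem fst_sh_zpow_eq_zero {a : R} (ha : a.fst = 0) (j : ℤ) : ((R.sh ^ j) a).fst = 0 := by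
  have e : R.augHom ((R.sh ^ j) a) = 0 := by
    rw [map_sh_zpow R.augHom_sh]
    change (R.sh ^ j) (Unitization.inl a.fst) = 0
    rw [ha, Unitization.inl_zero, map_zero]
  exact congrArg (fun r : R => r.fst) e

/-- Together with `tr_comm` this is cyclicity of the trace. -/
theorem tr_mul_left {a b : BOp} (ha : aug a = 0) (hb : aug b = 0) (d : BOp) :
    tr (a * d) b = tr a (d * b) := by
  rw [aug_eq_zero] at ha hb
  obtain ⟨N, hN⟩ := a.2
  obtain ⟨K, hK⟩ := d.2
  obtain ⟨M, hM⟩ := b.2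
  have e1 : ∀ k ∈ Finset.Icc (-M) (N + K),
      pairR ((a * d).1 k) ((R.sh ^ k) (b.1 (-k))) = ∑ j ∈ Finset.Icc (-M - K) N,
        pairR (a.1 j) ((R.sh ^ j) (d.1 (k - j)) * (R.sh ^ k) (b.1 (-k))) := fun k hk => by
    rw [Finset.mem_Icc] at hk
    rw [coe_mul, Op.mul_apply_eq_sum hN hK k 0 (lo := -M - K) (hi := N) (by omega) (by omega),
      pairR_sum_left]
    refine Finset.sum_congr rfl fun j _ => ?_
    rw [sub_zero, pairR_mul_left (ha j) (fst_sh_zpow_eq_zero (hb (-k)) k)]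
  have e2 : ∀ j ∈ Finset.Icc (-M - K) N,
      pairR (a.1 j) ((R.sh ^ j) ((d * b).1 (-j))) = ∑ k ∈ Finset.Icc (-M) (N + K),
        pairR (a.1 j) ((R.sh ^ j) (d.1 (k - j)) * (R.sh ^ k) (b.1 (-k))) := fun j hj => by
    rw [Finset.mem_Icc] at hj
    rw [coe_mul, Op.mul_apply_eq_sum hK hM (-j) j (lo := -M) (hi := N + K) (by omega) (by omega),
      map_sum, pairR_sum_right]
    refine Finset.sum_congr rfl fun k _ => ?_
    rw [map_mul, ← RingAut.mul_apply _ _ (b.1 _), ← zpow_add, add_sub_cancel,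
      show -j - (k - j) = -k by omega]
  rw [tr_eq_sum (Op.mul_eq_zero_of_lt hN hK) hM (lo := -M) (hi := N + K) le_rfl le_rfl,
    tr_eq_sum hN (Op.mul_eq_zero_of_lt hK hM) (lo := -M - K) (hi := N) (by omega) le_rfl,
    Finset.sum_congr rfl e1, Finset.sum_congr rfl e2, Finset.sum_comm]

theorem tr_dx_left (a b : BOp) : tr (dx a) b = -tr a (dx b) := by
  obtain ⟨N, hN⟩ := a.2
  obtain ⟨M, hM⟩ := b.2
  have d0 : R.dx 0 = 0 := map_zero R.dxHom
  have hN' : ∀ k, N < k → (dx a).1 k = 0 := fun k hk => by rw [dx_apply, hN k hk, d0]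
  have hM' : ∀ k, M < k → (dx b).1 k = 0 := fun k hk => by rw [dx_apply, hM k hk, d0]
  rw [tr_eq_sum hN' hM le_rfl le_rfl, tr_eq_sum hN hM' le_rfl le_rfl, ← Finset.sum_neg_distrib]
  refine Finset.sum_congr rfl fun k _ => ?_
  rw [dx_apply, dx_apply, pairR_dx_left]
  congr 2
  exact map_sh_zpow R.dxHom_sh k _

/-- Integration by parts handles `∂`, cyclicity handles the commutator with `A₁`. -/
theorem tr_cov_left {a b : BOp} (ha : aug a = 0) (hb : aug b = 0) (h : ℝ) :
    tr (cov h a) b = -tr a (cov h b) := by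
  rw [cov_def, cov_def, tr_sub_left, tr_sub_left, tr_sub_right, tr_sub_right, tr_dx_left,
    tr_mul_left ha hb, tr_comm (bA h * a), ← tr_mul_left hb ha, tr_comm _ a]
  abel

theorem tr_const_left (f : F) (b : BOp) :
    tr (const (Unitization.inr f)) b = sumInt f (omega b) := by
  rw [tr, finsum_eq_single _ 0]
  · rw [const_apply, if_pos rfl, pairR, Unitization.snd_inr]
    rfl
  · intro k hk
    rw [const_apply, if_neg hk, pairR_zero_left]

/-! ### Self-adjoint derivatives -/

/-- The functions whose Gâteaux derivative is self-adjoint. -/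
def selfAdj : Submodule ℝ F where
  carrier := {f | ∀ g k, sumInt (F.gat g f) k = sumInt (F.gat k f) g}
  zero_mem' g k := by simp [← sumIntL_apply]
  add_mem' {a b} ha hb g k := by
    rw [map_add, map_add, sumInt_add_left, sumInt_add_left, ha, hb]
  smul_mem' r a ha g k := by
    rw [map_smul, map_smul, sumInt_rsmul_left, sumInt_rsmul_left, ha]

theorem aug_const_inr (f : F) : aug (const (Unitization.inr f)) = 0 := by
  rw [aug_const, Unitization.fst_inr, Unitization.inl_zero, map_zero]

/-- With `S_g` the dressing variation, `∑∫ f ω(D)'[g]` is the trace of `f` against `[S_g, D]`. In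
the other order, `g` is the covariant derivative of `S_g`; moving it onto `[S_f, D]` yields `-[f,
D]` paired with `S_g`, which is the same trace by cyclicity. -/
theorem omega_mem_selfAdj {h : ℝ} (hh : h ≠ 0) {D : BOp} (hD : D ∈ flat h) :
    omega D ∈ selfAdj := by
  intro g f
  have ac : ∀ g, aug (dress h g * D - D * dress h g) = 0 := fun g => by
    rw [map_sub, map_mul, map_mul, aug_dress, zero_mul, mul_zero, sub_self]
  have e1 : cov h (dress h f * D - D * dress h f) =
      const (Unitization.inr f) * D - D * const (Unitization.inr f) := by
    rw [cov_lie, cov_dress hh, hD.1, mul_zero, zero_mul, sub_zero, add_zero]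
  have af := aug_const_inr f
  rw [gat_omega, gat_omega, gat_flat hh hD (aug_dress h g) (cov_dress hh g),
    gat_flat hh hD (aug_dress h f) (cov_dress hh f), sumInt_comm, ← tr_const_left,
    sumInt_comm _ g, ← tr_const_left, ← cov_dress hh g, tr_cov_left (aug_dress h g) (ac f), e1,
    tr_sub_right, tr_sub_right, tr_comm _ (dress h g * D), tr_mul_left (aug_dress h g) af,
    ← tr_mul_left af (aug_dress h g), tr_comm _ (dress h g)]
  abel

/-- Product rule, then self-adjointness exchanges the direction `g` with the other factor; the sign
comes from skewness of `∂`. -/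
theorem hasGradient_pair_dx (h : ℝ) {a b : F} (ha : a ∈ selfAdj) (hb : b ∈ selfAdj) :
    HasGradient h (pair h a (F.dx b)) (F.gat (F.dx b) a - F.gat (F.dx a) b) := by
  intro g
  rw [pair, map_smul, pair, gatV_sumInt, ha, F.gat_dx, sumInt_comm a, sumInt_dx_left, hb _,
    ← sub_eq_add_neg, ← sumInt_sub_left]

/-! ### Linearity of the operations -/

namespace F

/-- `∂` as a linear map. -/
def dxL : F →ₗ[ℝ] F where
  toFun := dx
  map_add' := dx_add
  map_smul' := dx_rsmul

/-- `E` as a linear map. -/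
def shL : F →ₗ[ℝ] F where
  toFun := sh
  map_add' := sh_add
  map_smul' := sh_rsmul

/-- A two-sided inverse of a linear map is linear. -/
def inverseL (S : F →ₗ[ℝ] F) (T : F → F) (h₁ : ∀ a, S (T a) = a) (h₂ : ∀ a, T (S a) = a) :
    F →ₗ[ℝ] F where
  toFun := T
  map_add' a b := by rw [← h₂ (T a + T b), map_add, h₁, h₁]
  map_smul' r a := by rw [RingHom.id_apply, ← h₂ (r • T a), map_smul, h₁]

/-- `∂⁻¹` as a linear map. -/
def dxInvL : F →ₗ[ℝ] F := inverseL dxL dxInv dx_dxInv dxInv_dx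

/-- `E⁻¹` as a linear map. -/
def shInvL : F →ₗ[ℝ] F := inverseL shL shInv sh_shInv shInv_sh

/-- `Δ⁻¹` as a linear map. -/
def delInvL : F →ₗ[ℝ] F := inverseL (shL - LinearMap.id) delInv del_delInv delInv_del

/-- Multiplication by a polynomial as a real linear map. -/
def smulL (p : P) : F →ₗ[ℝ] F where
  toFun a := p • a
  map_add' := smul_add p
  map_smul' r a := smul_comm p (MvPolynomial.C r : P) a

/-- Substitution as a linear map. -/
def substL (w : F) : F →ₗ[ℝ] F where
  toFun := subst w
  map_add' a b := Quotient.inductionOn₂ a b fun _ _ => rfl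
  map_smul' _ a := Quotient.inductionOn a fun _ => rfl

theorem substL_apply (w a : F) : substL w a = subst w a := rfl

theorem subst_mul (w a b : F) : subst w (a * b) = subst w a * subst w b :=
  Quotient.inductionOn₂ a b fun _ _ => rfl

theorem rsmul_mul (r : ℝ) (a b : F) : (r • a) * b = r • (a * b) :=
  smul_mul_assoc (MvPolynomial.C r : P) a b

theorem mul_rsmul (r : ℝ) (a b : F) : a * (r • b) = r • (a * b) :=
  mul_smul_comm (MvPolynomial.C r : P) a b

end F

/-! ### Commutators of Gâteaux derivatives -/

theorem gat_u (g : F) : F.gat g F.u = g := rfl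

/-- The commutator of two derivations that commute with all the linear operations is again of this
kind, hence determined by its value on `u`. -/
theorem gat_gat_sub (g k f : F) :
    F.gat g (F.gat k f) - F.gat k (F.gat g f) = F.gat (F.gat g k - F.gat k g) f := by
  induction f using F.ind with
  | c e =>
  have inv : ∀ (T : F →ₗ[ℝ] F), (∀ g a, F.gat g (T a) = T (F.gat g a)) → ∀ a,
      F.gat g (F.gat k a) - F.gat k (F.gat g a) = F.gat (F.gat g k - F.gat k g) a →
      F.gat g (F.gat k (T a)) - F.gat k (F.gat g (T a)) =
        F.gat (F.gat g k - F.gat k g) (T a) := fun T hT a ha => by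
    rw [hT, hT, hT, hT, hT, ← map_sub, ha]
  induction e with
  | u => rfl
  | zero =>
    change F.gat g (F.gat k 0) - F.gat k (F.gat g 0) = F.gat (F.gat g k - F.gat k g) 0
    simp
  | add a b ha hb =>
    rw [F.mk_add]
    simp only [map_add] at *
    rw [← ha, ← hb]
    abel
  | mul a b ha hb =>
    rw [F.mk_mul]
    simp only [F.gat_mul, map_add] at *
    rw [← ha, ← hb, sub_mul, mul_sub]
    abel
  | smul p a ha => exact inv (F.smulL p) (fun g a => F.gat_smul g p a) _ ha
  | dx a ha => exact inv F.dxL F.gat_dx _ ha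
  | dxInv a ha => exact inv F.dxInvL (fun g a => Quotient.inductionOn a fun _ => rfl) _ ha
  | sh a ha => exact inv F.shL F.gat_sh _ ha
  | shInv a ha => exact inv F.shInvL (fun g a => Quotient.inductionOn a fun _ => rfl) _ ha
  | delInv a ha => exact inv F.delInvL (fun g a => Quotient.inductionOn a fun _ => rfl) _ ha

theorem gatV_gatV_sub (g k : F) (v : V) :
    gatV g (gatV k v) - gatV k (gatV g v) = gatV (F.gat g k - F.gat k g) v := by
  induction v using V.induction with
  | h0 => simp
  | ha v w hv hw =>
    simp only [map_add]
    rw [← hv, ← hw]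
    abel
  | hi a b =>
    simp only [gatV_sumInt, map_add, ← gat_gat_sub, sumInt_sub_left, sumInt_sub_right]
    abel

/-- Differentiate the symmetry relation of `f` along `u`; the corrections from commuting derivatives
are themselves governed by the symmetry of `f`. -/
theorem gat_u_mem_selfAdj {f : F} (hf : f ∈ selfAdj) : F.gat F.u f ∈ selfAdj := by
  intro g k
  have e := congrArg (gatV F.u) (hf g k)
  have c : ∀ g, F.gat F.u (F.gat g f) = F.gat g (F.gat F.u f) + F.gat (F.gat F.u g - g) f :=
    fun g => by
      have e1 := gat_gat_sub F.u g f
      rw [gat_u] at e1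
      rw [← e1]
      abel
  rw [gatV_sumInt, gatV_sumInt, c, c, sumInt_add_left, sumInt_add_left, hf _ k, hf _ g,
    sumInt_sub_right, sumInt_sub_right, hf g k, hf g (F.gat F.u k)] at e
  -- By the symmetry of `f`, the correction terms on the two sides form one and the same expression,
  -- which cancels.
  exact add_right_cancel (b := sumInt (F.gat k f) (F.gat F.u g) - sumInt (F.gat k f) g +
    sumInt (F.gat (F.gat F.u k) f) g) (by
      convert e using 1
      · rw [hf (F.gat F.u k) g]; abel
      · rw [hf (F.gat F.u k) g]; abel)

/-! ### The grading by the degree in `u` -/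

/-- The functions of degree `k` in `u`. -/
def homog (k : ℕ) : Submodule ℝ F where
  carrier := {f | (∀ r : ℝ, F.subst (r • F.u) f = r ^ k • f) ∧ F.gat F.u f = (k : ℝ) • f}
  zero_mem' := ⟨fun r => by rw [← F.substL_apply, map_zero, smul_zero],
    by rw [map_zero, smul_zero]⟩
  add_mem' {a b} ha hb := ⟨fun r => by
    rw [← F.substL_apply, map_add, F.substL_apply, F.substL_apply, ha.1, hb.1, smul_add],
    by rw [map_add, ha.2, hb.2, smul_add]⟩
  smul_mem' c a ha := ⟨fun r => by
    rw [← F.substL_apply, map_smul, F.substL_apply, ha.1, smul_comm],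
    by rw [map_smul, ha.2, smul_comm]⟩

theorem mul_mem_homog {i j : ℕ} {a b : F} (ha : a ∈ homog i) (hb : b ∈ homog j) :
    a * b ∈ homog (i + j) :=
  ⟨fun r => by
    rw [F.subst_mul, ha.1, hb.1, F.rsmul_mul, F.mul_rsmul, smul_smul, pow_add],
   by rw [F.gat_mul, ha.2, hb.2, F.rsmul_mul, F.mul_rsmul, ← add_smul, Nat.cast_add]⟩

/-- Degrees start at one because expressions have no constant term, and every linear operation
preserves the degree. -/
theorem mem_iSup_homog (f : F) : f ∈ ⨆ k, homog (k + 1) := by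
  have lin : ∀ (T : F →ₗ[ℝ] F), (∀ a, F.gat F.u (T a) = T (F.gat F.u a)) →
      (∀ w a, F.subst w (T a) = T (F.subst w a)) → ∀ a, a ∈ ⨆ k, homog (k + 1) →
      T a ∈ ⨆ k, homog (k + 1) := fun T h₁ h₂ a ha => by
    have : (⨆ k, homog (k + 1)) ≤ (⨆ k, homog (k + 1)).comap T := by
      refine iSup_le fun k b hb => Submodule.mem_iSup_of_mem k ?_
      exact ⟨fun r => by rw [h₂, hb.1, map_smul], by rw [h₁, hb.2, map_smul]⟩
    exact this ha
  induction f using F.ind with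
  | c e =>
  induction e with
  | u =>
    exact Submodule.mem_iSup_of_mem (p := fun k => homog (k + 1)) 0
      ⟨fun r => by rw [zero_add, pow_one]; rfl, by rw [zero_add, Nat.cast_one, one_smul]; rfl⟩
  | zero => exact zero_mem _
  | add a b ha hb => exact add_mem ha hb
  | mul a b ha hb =>
    rw [F.mk_mul]
    refine Submodule.iSup_induction _ (motive := fun a => a * F.mk b ∈ ⨆ k, homog (k + 1)) ha
      (fun i a hi => ?_) (by rw [zero_mul]; exact zero_mem _)
      (fun a a' h h' => by rw [add_mul]; exact add_mem h h')
    refine Submodule.iSup_induction _ (motive := fun b => a * b ∈ ⨆ k, homog (k + 1)) hb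
      (fun j b hj => ?_) (by rw [mul_zero]; exact zero_mem _)
      (fun b b' h h' => by rw [mul_add]; exact add_mem h h')
    refine Submodule.mem_iSup_of_mem (i + j + 1) ?_
    rw [show i + j + 1 + 1 = i + 1 + (j + 1) by ring]
    exact mul_mem_homog hi hj
  | smul p a ha =>
    exact lin (F.smulL p) (fun a => F.gat_smul _ p a)
      (fun w a => Quotient.inductionOn a fun _ => rfl) _ ha
  | dx a ha =>
    exact lin F.dxL (F.gat_dx _) (fun w a => Quotient.inductionOn a fun _ => rfl) _ ha
  | dxInv a ha =>
    exact lin F.dxInvL (fun a => Quotient.inductionOn a fun _ => rfl)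
      (fun w a => Quotient.inductionOn a fun _ => rfl) _ ha
  | sh a ha =>
    exact lin F.shL (F.gat_sh _) (fun w a => Quotient.inductionOn a fun _ => rfl) _ ha
  | shInv a ha =>
    exact lin F.shInvL (fun a => Quotient.inductionOn a fun _ => rfl)
      (fun w a => Quotient.inductionOn a fun _ => rfl) _ ha
  | delInv a ha =>
    exact lin F.delInvL (fun a => Quotient.inductionOn a fun _ => rfl)
      (fun w a => Quotient.inductionOn a fun _ => rfl) _ ha

theorem exists_homog_decomposition (f : F) :
    ∃ (s : Finset ℕ) (c : ℕ → F), (∀ k, c k ∈ homog (k + 1)) ∧ f = ∑ k ∈ s, c k := by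
  obtain ⟨c, hc, e⟩ := (Submodule.mem_iSup_iff_exists_finsupp _ _).1 (mem_iSup_homog f)
  exact ⟨c.support, c, hc, e.symm⟩

/-- Functionals are sums of eigenvectors of the derivative along `u`, with positive eigenvalues (the
total degrees). Independence of eigenspaces then leaves nothing for eigenvalue zero. -/
theorem gatV_u_eq_zero {v : V} (hv : gatV F.u v = 0) : v = 0 := by
  have key : v ∈ ⨆ μ : ℝ, ⨆ _ : μ ≠ 0, Module.End.eigenspace (gatV F.u) μ := by
    clear hv
    induction v using V.induction with
    | h0 => exact zero_mem _
    | ha v w hv hw => exact add_mem hv hw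
    | hi a b =>
      refine Submodule.iSup_induction _ (motive := fun a => sumInt a b ∈ _) (mem_iSup_homog a)
        (fun i a hi => ?_) (by rw [← sumIntL_apply, map_zero]; exact zero_mem _)
        (fun a a' h h' => by rw [sumInt_add_left]; exact add_mem h h')
      refine Submodule.iSup_induction _ (motive := fun b => sumInt a b ∈ _) (mem_iSup_homog b)
        (fun j b hj => ?_) (by rw [← sumIntL_apply, map_zero]; exact zero_mem _)
        (fun b b' h h' => by rw [sumInt_add_right]; exact add_mem h h')
      refine Submodule.mem_iSup_of_mem (((i + 1 : ℕ) : ℝ) + ((j + 1 : ℕ) : ℝ))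
        (Submodule.mem_iSup_of_mem (by positivity) ?_)
      rw [Module.End.mem_eigenspace_iff, gatV_sumInt, hi.2, hj.2, sumInt_rsmul_left,
        sumInt_rsmul_right, ← add_smul]
  have h0 : v ∈ Module.End.eigenspace (gatV F.u) 0 := by
    rw [Module.End.mem_eigenspace_iff, hv, zero_smul]
  exact (Submodule.disjoint_def.1
    (Module.End.eigenspaces_iSupIndep (gatV F.u) 0)) v h0 key

theorem HasGradient.unique {h : ℝ} {I J : V} {f : F} (hI : HasGradient h I f)
    (hJ : HasGradient h J f) : I = J := by
  rw [← sub_eq_zero]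
  refine gatV_u_eq_zero ?_
  rw [map_sub, hI, hJ, sub_self]

/-! ### Potentials -/

theorem aeval_gat_u_mem_selfAdj {f : F} (hf : f ∈ selfAdj) (p : Polynomial ℝ) :
    Polynomial.aeval (F.gat F.u : Module.End ℝ F) p f ∈ selfAdj := by
  induction p using Polynomial.induction_on' with
  | add p q hp hq => rw [map_add, LinearMap.add_apply]; exact add_mem hp hq
  | monomial n a =>
    rw [Polynomial.aeval_monomial, ← Algebra.smul_def, LinearMap.smul_apply]
    refine Submodule.smul_mem _ _ ?_
    induction n with
    | zero => exact hf
    | succ n ih => rw [pow_succ', Module.End.mul_apply]; exact gat_u_mem_selfAdj ih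

theorem aeval_gat_u_of_mem_homog {k : ℕ} {f : F} (hf : f ∈ homog k) (p : Polynomial ℝ) :
    Polynomial.aeval (F.gat F.u : Module.End ℝ F) p f = p.eval (k : ℝ) • f := by
  induction p using Polynomial.induction_on' with
  | add p q hp hq => rw [map_add, LinearMap.add_apply, hp, hq, Polynomial.eval_add, add_smul]
  | monomial n a =>
    rw [Polynomial.aeval_monomial, ← Algebra.smul_def, LinearMap.smul_apply,
      Polynomial.eval_monomial, mul_smul]
    congr 1
    induction n with
    | zero => simp
    | succ n ih => rw [pow_succ', Module.End.mul_apply, ih, map_smul, hf.2, smul_smul, pow_succ]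

/-- The potential is `(w, u)`, where `w` divides the part of degree `d` of `f` by `d + 1`. If `w`
has a self-adjoint derivative, the gradient of `(w, u)` is `w'[u] + w`, which is `f`. -/
theorem hasGradient_potential (h : ℝ) {f : F} (hf : f ∈ selfAdj) :
    HasGradient h (potential h f) f := by
  obtain ⟨s, c, hc, rfl⟩ := exists_homog_decomposition f
  set w : F := ∑ k ∈ s, ((k : ℝ) + 2)⁻¹ • c k with hw
  have hsub : ∀ r : ℝ, pair h (F.subst (r • F.u) (∑ k ∈ s, c k)) F.u =
      ∑ k ∈ s, r ^ (k + 1) • pair h (c k) F.u := fun r => by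
    rw [← F.substL_apply, map_sum, pair, ← sumIntL_apply, map_sum, LinearMap.sum_apply,
      Finset.smul_sum]
    refine Finset.sum_congr rfl fun k _ => ?_
    rw [F.substL_apply, (hc k).1, sumIntL_apply, sumInt_rsmul_left, smul_comm]
    rfl
  have hint : IsIntegralV (fun r => pair h (F.subst (r • F.u) (∑ k ∈ s, c k)) F.u)
      (pair h w F.u) := by
    intro φ
    have e : (fun r => φ (pair h (F.subst (r • F.u) (∑ k ∈ s, c k)) F.u)) =
        fun r : ℝ => ∑ k ∈ s, r ^ (k + 1) * φ (pair h (c k) F.u) := by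
      funext r
      rw [hsub, map_sum]
      simp only [map_smul, smul_eq_mul]
    have hi : ∀ k ∈ s, IntervalIntegrable (fun r : ℝ => r ^ (k + 1) * φ (pair h (c k) F.u))
        MeasureTheory.volume 0 1 := fun k _ =>
      Continuous.intervalIntegrable (by fun_prop) _ _
    simp only [e]
    refine ⟨Continuous.intervalIntegrable (by fun_prop) _ _, ?_⟩
    rw [intervalIntegral.integral_finsetSum hi, hw, pair, ← sumIntL_apply, map_sum,
      LinearMap.sum_apply, Finset.smul_sum, map_sum]
    refine Finset.sum_congr rfl fun k _ => ?_
    rw [intervalIntegral.integral_mul_const, integral_pow, sumIntL_apply, sumInt_rsmul_left,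
      smul_comm, map_smul, smul_eq_mul]
    congr 1
    push_cast
    norm_num
    ring
  have hpot : potential h (∑ k ∈ s, c k) = pair h w F.u := by
    have ex : ∃ v, IsIntegralV (fun r => pair h (F.subst (r • F.u) (∑ k ∈ s, c k)) F.u) v :=
      ⟨_, hint⟩
    -- Linear forms separate points, so the chosen integral is the one computed above.
    rw [potential, dif_pos ex, ← sub_eq_zero, ← Module.forall_dual_apply_eq_zero_iff ℝ]
    intro φ
    rw [map_sub, (ex.choose_spec φ).2, (hint φ).2, sub_self]
  have hws : w ∈ selfAdj := by
    -- Self-adjointness is known for `f`, not for its homogeneous parts. Interpolating `1 / (d + 1)`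
    -- at the occurring degrees exhibits `w` as a polynomial in the derivative along `u`, applied to
    -- `f`.
    set p := Lagrange.interpolate s (fun k : ℕ => ((k + 1 : ℕ) : ℝ))
      (fun k : ℕ => ((k : ℝ) + 2)⁻¹) with hp
    have e : w = Polynomial.aeval (F.gat F.u : Module.End ℝ F) p (∑ k ∈ s, c k) := by
      rw [map_sum]
      refine Finset.sum_congr rfl fun k hk => ?_
      rw [aeval_gat_u_of_mem_homog (hc k), hp]
      rw [Lagrange.eval_interpolate_at_node (v := fun k : ℕ => ((k + 1 : ℕ) : ℝ)) _ ?_ hk]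
      intro i _ j _ hij
      simpa using hij
    rw [e]
    exact aeval_gat_u_mem_selfAdj hf p
  have hN : F.gat F.u w + w = ∑ k ∈ s, c k := by
    rw [hw, map_sum, ← Finset.sum_add_distrib]
    refine Finset.sum_congr rfl fun k _ => ?_
    rw [map_smul, (hc k).2, smul_smul, ← add_smul]
    have : ((k : ℝ) + 2)⁻¹ * ((k + 1 : ℕ) : ℝ) + ((k : ℝ) + 2)⁻¹ = 1 := by
      have : (k : ℝ) + 2 ≠ 0 := by positivity
      push_cast
      field_simp
      ring
    rw [this, one_smul]
  intro g
  rw [hpot, pair, map_smul, gatV_sumInt, gat_u, hws, ← sumInt_add_left, hN]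
  rfl

/-! ### The Poisson bracket -/

theorem pair_comm (h : ℝ) (f g : F) : pair h f g = pair h g f := by
  rw [pair, sumInt_comm]; rfl

theorem pair_dx_left (h : ℝ) (f g : F) : pair h (F.dx f) g = -pair h f (F.dx g) := by
  rw [pair, sumInt_dx_left, smul_neg]; rfl

theorem pair_add_left (h : ℝ) (f f' g : F) : pair h (f + f') g = pair h f g + pair h f' g := by
  rw [pair, sumInt_add_left, smul_add]; rfl

theorem pair_rsmul_left (h r : ℝ) (f g : F) : pair h (r • f) g = r • pair h f g := by
  rw [pair, sumInt_rsmul_left, smul_comm]; rfl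

namespace HasGradient

variable {h : ℝ} {I J K : V} {f g k : F}

theorem zero (h : ℝ) : HasGradient h 0 0 := fun g => by
  rw [map_zero, pair, ← sumIntL_apply, map_zero, LinearMap.zero_apply, smul_zero]

theorem add (hI : HasGradient h I f) (hJ : HasGradient h J g) : HasGradient h (I + J) (f + g) :=
  fun k => by rw [map_add, hI, hJ, pair_add_left]

theorem smul (r : ℝ) (hI : HasGradient h I f) : HasGradient h (r • I) (r • f) :=
  fun k => by rw [map_smul, hI, pair_rsmul_left]

theorem sub (hI : HasGradient h I f) (hJ : HasGradient h J g) : HasGradient h (I - J) (f - g) := by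
  have e := hI.add (hJ.smul (-1))
  rwa [neg_one_smul, neg_one_smul, ← sub_eq_add_neg, ← sub_eq_add_neg] at e

/-- Replacing one gradient by another does not change its pairing with any function, since both
represent the same derivative; skewness of `∂` handles the second slot. -/
theorem poisson_eq (hI : HasGradient h I f) (hJ : HasGradient h J g) :
    poisson h I J = pair h f (F.dx g) := by
  have spec : ∀ {I : V} {f : F}, HasGradient h I f → HasGradient h I (grad h I) := fun {I f} H => by
    have c : ∃ f, HasGradient h I f := ⟨f, H⟩
    rw [grad, dif_pos c]
    exact c.choose_spec
  rw [poisson, ← spec hI, hI, ← neg_neg (pair h f (F.dx (grad h J))), ← pair_dx_left, pair_comm,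
    ← spec hJ, hJ, pair_comm, pair_dx_left, neg_neg]

theorem poisson_eq_gatV (hI : HasGradient h I f) (hJ : HasGradient h J g) :
    poisson h I J = gatV (F.dx g) I := by rw [hI.poisson_eq hJ, hI]

theorem poisson_antisymm (hI : HasGradient h I f) (hJ : HasGradient h J g) :
    poisson h I J = -poisson h J I := by
  rw [hI.poisson_eq hJ, hJ.poisson_eq hI, pair_comm, pair_dx_left]

theorem poisson_add_left (hI : HasGradient h I f) (hJ : HasGradient h J g)
    (hK : HasGradient h K k) : poisson h (I + J) K = poisson h I K + poisson h J K := by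
  rw [(hI.add hJ).poisson_eq_gatV hK, hI.poisson_eq_gatV hK, hJ.poisson_eq_gatV hK, map_add]

theorem poisson_smul_left (r : ℝ) (hI : HasGradient h I f) (hK : HasGradient h K k) :
    poisson h (r • I) K = r • poisson h I K := by
  rw [(hI.smul r).poisson_eq_gatV hK, hI.poisson_eq_gatV hK, map_smul]

theorem poisson_add_right (hI : HasGradient h I f) (hJ : HasGradient h J g)
    (hK : HasGradient h K k) : poisson h K (I + J) = poisson h K I + poisson h K J := by
  rw [hK.poisson_antisymm (hI.add hJ), hI.poisson_add_left hJ hK, hK.poisson_antisymm hI,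
    hK.poisson_antisymm hJ, neg_add]

theorem poisson_smul_right (r : ℝ) (hI : HasGradient h I f) (hK : HasGradient h K k) :
    poisson h K (r • I) = r • poisson h K I := by
  rw [hK.poisson_antisymm (hI.smul r), hI.poisson_smul_left r hK, hK.poisson_antisymm hI,
    smul_neg]

theorem poisson_self (hI : HasGradient h I f) : poisson h I I = 0 := by
  have e := hI.poisson_antisymm hI
  rw [eq_neg_iff_add_eq_zero, ← two_smul ℝ] at e
  exact (smul_eq_zero.1 e).resolve_left two_ne_zero

/-- This is the symmetry of second derivatives of `I`. -/
theorem mem_selfAdj (hh : h ≠ 0) (hI : HasGradient h I f) : f ∈ selfAdj := by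
  intro g k
  have e := gatV_gatV_sub g k I
  rw [hI, hI, hI, pair, pair, pair, map_smul, map_smul, gatV_sumInt, gatV_sumInt, ← smul_sub,
    sumInt_sub_right] at e
  have e2 : sumInt (F.gat g f) k + sumInt f (F.gat g k) -
      (sumInt (F.gat k f) g + sumInt f (F.gat k g)) =
      sumInt f (F.gat g k) - sumInt f (F.gat k g) :=
    smul_right_injective V (show h ^ 2 / 2 ≠ 0 by positivity) e
  rw [← sub_eq_zero]
  linear_combination (norm := module) e2

theorem poisson (hh : h ≠ 0) (hI : HasGradient h I f) (hJ : HasGradient h J g) :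
    HasGradient h (poisson h I J) (F.gat (F.dx g) f - F.gat (F.dx f) g) := by
  rw [hI.poisson_eq hJ]
  exact hasGradient_pair_dx h (hI.mem_selfAdj hh) (hJ.mem_selfAdj hh)

/-- The Hamiltonian direction of `{J, K}` is the commutator of those of `J` and `K`, so the
derivative of `I` along it is a commutator of derivatives. -/
theorem poisson_poisson (hh : h ≠ 0) (hI : HasGradient h I f) (hJ : HasGradient h J g)
    (hK : HasGradient h K k) : DDKP.poisson h I (DDKP.poisson h J K) =
      gatV (F.dx k) (DDKP.poisson h I J) - gatV (F.dx g) (DDKP.poisson h I K) := by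
  rw [hI.poisson_eq_gatV (hJ.poisson hh hK), hI.poisson_eq_gatV hJ, hI.poisson_eq_gatV hK,
    gatV_gatV_sub, F.dx_sub, F.gat_dx, F.gat_dx]

theorem jacobi (hh : h ≠ 0) (hI : HasGradient h I f) (hJ : HasGradient h J g)
    (hK : HasGradient h K k) : DDKP.poisson h I (DDKP.poisson h J K) +
      DDKP.poisson h J (DDKP.poisson h K I) + DDKP.poisson h K (DDKP.poisson h I J) = 0 := by
  have e1 := hI.poisson_antisymm (hJ.poisson hh hK)
  have e2 := hJ.poisson_antisymm (hK.poisson hh hI)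
  have e3 := hK.poisson_antisymm (hI.poisson hh hJ)
  rw [(hJ.poisson hh hK).poisson_eq_gatV hI] at e1
  rw [(hK.poisson hh hI).poisson_eq_gatV hJ] at e2
  rw [(hI.poisson hh hJ).poisson_eq_gatV hK] at e3
  have f1 := hI.poisson_poisson hh hJ hK
  have f2 := hJ.poisson_poisson hh hK hI
  have f3 := hK.poisson_poisson hh hI hJ
  rw [hI.poisson_antisymm hK, map_neg] at f1
  rw [hJ.poisson_antisymm hI, map_neg] at f2
  rw [hK.poisson_antisymm hJ, map_neg] at f3
  -- The commutator formulas express the cyclic sum as `-2` times itself once antisymmetry is used;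
  -- hence three times it vanishes.
  have e : (3 : ℝ) • (DDKP.poisson h I (DDKP.poisson h J K) +
      DDKP.poisson h J (DDKP.poisson h K I) + DDKP.poisson h K (DDKP.poisson h I J)) = 0 := by
    linear_combination (norm := module) f1 + f2 + f3 + (2 : ℝ) • e1 + (2 : ℝ) • e2 + (2 : ℝ) • e3
  exact (smul_eq_zero.1 e).resolve_left three_ne_zero

/-- The bracket and `K` have the same gradient by `gat_omega_sub`. -/
theorem poisson_eq_of_flat (hh : h ≠ 0) {D D' : BOp} (hD : D ∈ flat h) (hD' : D' ∈ flat h)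
    (hI : HasGradient h I (omega D)) (hJ : HasGradient h J (omega D'))
    (hK : HasGradient h K (omega (D * D' - D' * D))) : DDKP.poisson h I J = K := by
  refine HasGradient.unique (hI.poisson hh hJ) ?_
  rwa [gat_omega_sub hh hD' hD]

end HasGradient

/-! ### Lie algebras of functionals -/

/-- The functionals which have a gradient. -/
def gradV (h : ℝ) : Submodule ℝ V where
  carrier := {I | ∃ f, HasGradient h I f}
  zero_mem' := ⟨0, HasGradient.zero h⟩
  add_mem' := fun ⟨_, ha⟩ ⟨_, hb⟩ => ⟨_, ha.add hb⟩
  smul_mem' r _ := fun ⟨_, ha⟩ => ⟨_, ha.smul r⟩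

theorem isLieAlg_gradV {h : ℝ} (hh : h ≠ 0) : IsLieAlg (poisson h) (gradV h) where
  closed := fun _ ⟨_, ha⟩ _ ⟨_, hb⟩ => ⟨_, ha.poisson hh hb⟩
  add_left := fun _ ⟨_, ha⟩ _ ⟨_, hb⟩ _ ⟨_, hc⟩ => ha.poisson_add_left hb hc
  smul_left := fun r _ ⟨_, ha⟩ _ ⟨_, hb⟩ => ha.poisson_smul_left r hb
  add_right := fun _ ⟨_, ha⟩ _ ⟨_, hb⟩ _ ⟨_, hc⟩ => hb.poisson_add_right hc ha
  smul_right := fun r _ ⟨_, ha⟩ _ ⟨_, hb⟩ => hb.poisson_smul_right r ha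
  self := fun _ ⟨_, ha⟩ => ha.poisson_self
  jacobi := fun _ ⟨_, ha⟩ _ ⟨_, hb⟩ _ ⟨_, hc⟩ => ha.jacobi hh hb hc

/-- A Lie algebra of functionals gives a Lie algebra of functionals depending on the time. -/
theorem IsLieAlg.pi {br : V → V → V} {W : Submodule ℝ V} (H : IsLieAlg br W) :
    IsLieAlg (fun a b : ℝ → V => fun t => br (a t) (b t)) (Submodule.pi Set.univ fun _ => W) where
  closed _ ha _ hb t ht := H.closed _ (ha t ht) _ (hb t ht)
  add_left _ ha _ hb _ hc := funext fun t =>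
    H.add_left _ (ha t trivial) _ (hb t trivial) _ (hc t trivial)
  smul_left r _ ha _ hb := funext fun t => H.smul_left r _ (ha t trivial) _ (hb t trivial)
  add_right _ ha _ hb _ hc := funext fun t =>
    H.add_right _ (ha t trivial) _ (hb t trivial) _ (hc t trivial)
  smul_right r _ ha _ hb := funext fun t => H.smul_right r _ (ha t trivial) _ (hb t trivial)
  self _ ha := funext fun t => H.self _ (ha t trivial)
  jacobi _ ha _ hb _ hc := funext fun t =>
    H.jacobi _ (ha t trivial) _ (hb t trivial) _ (hc t trivial)

/-- A subspace of a Lie algebra is a Lie algebra if a spanning set has its brackets in it. -/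
theorem IsLieAlg.span {M : Type} [AddCommGroup M] [Module ℝ M] {br : M → M → M}
    {W : Submodule ℝ M} (H : IsLieAlg br W) {S : Set M} (hS : S ⊆ W)
    (hc : ∀ a ∈ S, ∀ b ∈ S, br a b ∈ Submodule.span ℝ S) : IsLieAlg br (Submodule.span ℝ S) := by
  have hg : Submodule.span ℝ S ≤ W := Submodule.span_le.2 hS
  refine ⟨fun a ha b hb => ?_, fun a ha b hb c hc => H.add_left a (hg ha) b (hg hb) c (hg hc),
    fun r a ha b hb => H.smul_left r a (hg ha) b (hg hb),
    fun a ha b hb c hc => H.add_right a (hg ha) b (hg hb) c (hg hc),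
    fun r a ha b hb => H.smul_right r a (hg ha) b (hg hb), fun a ha => H.self a (hg ha),
    fun a ha b hb c hc => H.jacobi a (hg ha) b (hg hb) c (hg hc)⟩
  induction ha, hb using Submodule.span_induction₂ with
  | mem_mem a b ha hb => exact hc a ha b hb
  | zero_left b hb =>
    have e := H.smul_left 0 0 W.zero_mem b (hg hb)
    rw [zero_smul, zero_smul] at e
    rw [e]
    exact zero_mem _
  | zero_right a ha =>
    have e := H.smul_right 0 a (hg ha) 0 W.zero_mem
    rw [zero_smul, zero_smul] at e
    rw [e]
    exact zero_mem _
  | add_left a a' b ha ha' hb h1 h2 =>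
    rw [H.add_left a (hg ha) a' (hg ha') b (hg hb)]
    exact add_mem h1 h2
  | add_right a b b' ha hb hb' h1 h2 =>
    rw [H.add_right a (hg ha) b (hg hb) b' (hg hb')]
    exact add_mem h1 h2
  | smul_left r a b ha hb h1 =>
    rw [H.smul_left r a (hg ha) b (hg hb)]
    exact Submodule.smul_mem _ _ h1
  | smul_right r a b ha hb h1 =>
    rw [H.smul_right r a (hg ha) b (hg hb)]
    exact Submodule.smul_mem _ _ h1

/-! ### The Hamiltonians -/

section Hamiltonians

variable {h : ℝ} (hh : h ≠ 0)
include hh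

theorem omega_lie_pow_bL_bN (l j : ℕ) : omega (bL h ^ l * bN h j - bN h j * bL h ^ l) =
    (l : ℝ) • (h • omega (bL h ^ (l + j)) + omega (bL h ^ (l + j - 1))) := by
  rw [lie_pow_bL_bN hh, map_nsmul, map_add, omega_const_cst_mul, Nat.cast_smul_eq_nsmul]

theorem omega_lie_bN_bN (i j : ℕ) : omega (bN h i * bN h j - bN h j * bN h i) =
    ((i : ℝ) - j) • (h • omega (bN h (i + j)) + omega (bN h (i + j - 1))) := by
  rw [lie_bN_bN hh, map_zsmul, map_add, omega_const_cst_mul, ← Int.cast_smul_eq_zsmul ℝ]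
  push_cast
  rfl

theorem hasGradient_pair_omega {D D' : BOp} (hD : D ∈ flat h) (hD' : D' ∈ flat h) :
    HasGradient h (pair h (omega D) (F.dx (omega D'))) (omega (D * D' - D' * D)) := by
  rw [← gat_omega_sub hh hD' hD]
  exact hasGradient_pair_dx h (omega_mem_selfAdj hh hD) (omega_mem_selfAdj hh hD')

/-- `(γ_(s-1), σ_2)` has as gradient `ω` of `[L^(s-1), M L] = (s-1)(h L^s + L^(s-1))`; the recursion
solves this for the term in `L^s`. -/
theorem hasGradient_hamH : ∀ m : ℕ, HasGradient h (hamH h m) (omega (bL h ^ m))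
  | 0 => HasGradient.zero h
  | 1 => fun g => by
    have e : omega (bL h ^ 1) = F.u := by
      rw [pow_one]
      change (Unitization.inr F.u - cst h⁻¹ : R).snd = F.u
      rw [R.snd_sub, Unitization.snd_inr, cst, Unitization.snd_inl, sub_zero]
    have e2 : gatV g (pair h F.u F.u) = (2 : ℝ) • pair h F.u g := by
      rw [pair, map_smul, gatV_sumInt, gat_u, sumInt_comm g, ← two_smul ℝ, smul_comm]
      rfl
    rw [e, hamH, map_smul, e2, smul_smul, one_div_mul_cancel two_ne_zero, one_smul]
  | s + 2 => by
    have e := ((((hasGradient_pair_omega hh (pow_bL_mem_flat hh (s + 1))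
      (bN_mem_flat hh 1)).smul (1 / ((s : ℝ) + 1))).sub (hasGradient_hamH (s + 1))).smul h⁻¹)
    rw [omega_lie_pow_bL_bN hh, Nat.add_sub_cancel, ← flowS_eq hh, ← gam_eq hh] at e
    rw [hamH]
    convert e using 1
    have hs : (s : ℝ) + 1 ≠ 0 := by positivity
    rw [smul_smul]
    push_cast
    rw [one_div_mul_cancel hs, one_smul, add_sub_cancel_right, smul_smul, inv_mul_cancel₀ hh,
      one_smul]

/-- The same mechanism with `[M L^(s-2), M L] = (s-3)(h M L^(s-1) + M L^(s-2))`; the index of `J`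
exceeds the power of `L` by one. -/
theorem hasGradient_hamJ : ∀ m : ℕ, HasGradient h (hamJ h (m + 1)) (omega (bN h m))
  | 0 => fun g => by
    have e : omega (bN h 0) = h • varX • F.u := by
      rw [bN, pow_zero, mul_one, omega_apply, bM, BOp.add_apply, bM0_apply, negOp_apply,
        if_neg (by omega), if_pos rfl, if_neg (by omega), add_zero, Unitization.snd_add,
        Unitization.snd_inl, Unitization.snd_inr, zero_add, mul_smul]
      rfl
    have e2 : gatV g (pair h (varX • F.u) F.u) = (2 : ℝ) • pair h (varX • F.u) g := by
      rw [pair, map_smul, gatV_sumInt, F.gat_smul, gat_u, sumInt_smul_left, sumInt_comm g,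
        ← two_smul ℝ, smul_comm]
      rfl
    rw [e, hamJ, map_smul, e2, smul_smul, pair_rsmul_left, div_mul_cancel₀ _ two_ne_zero]
  | 1 => by
    have e := ((((hasGradient_pair_omega hh (bN_mem_flat hh 0)
      (bN_mem_flat hh 1)).smul (1 / ((2 : ℝ) - 3))).sub (hasGradient_hamJ 0)).smul h⁻¹)
    rw [omega_lie_bN_bN hh, zero_add, Nat.sub_self, ← flowS_eq hh, ← omg_eq hh] at e
    rw [hamJ]
    convert e using 1
    rw [← omg_eq hh]
    norm_num
    rw [smul_smul, inv_mul_cancel₀ hh, one_smul]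
  -- For `J_3` the commutator is that of `M L` with itself and the recursion gives nothing; the
  -- potential exists by self-adjointness.
  | 2 => by
    rw [hamJ, omg_eq hh]
    exact hasGradient_potential h (omega_mem_selfAdj hh (bN_mem_flat hh 2))
  | s + 3 => by
    have e := ((((hasGradient_pair_omega hh (bN_mem_flat hh (s + 2))
      (bN_mem_flat hh 1)).smul (1 / ((s : ℝ) + 1))).sub (hasGradient_hamJ (s + 2))).smul h⁻¹)
    rw [omega_lie_bN_bN hh, Nat.add_sub_cancel, ← flowS_eq hh, ← omg_eq hh] at e
    rw [hamJ]
    convert e using 1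
    have hs : (s : ℝ) + 1 ≠ 0 := by positivity
    rw [smul_smul]
    push_cast
    rw [show (s : ℝ) + 2 - 1 = s + 1 by ring, one_div_mul_cancel hs, one_smul, omg_eq hh,
      add_sub_cancel_right, smul_smul, inv_mul_cancel₀ hh, one_smul]

theorem poisson_hamH_hamH (l r : ℕ) : poisson h (hamH h l) (hamH h r) = 0 :=
  HasGradient.poisson_eq_of_flat hh (pow_bL_mem_flat hh l) (pow_bL_mem_flat hh r)
    (hasGradient_hamH hh l) (hasGradient_hamH hh r) (by
      rw [← pow_add, ← pow_add, add_comm, sub_self, map_zero]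
      exact HasGradient.zero h)

theorem poisson_hamH_hamJ (l j : ℕ) : poisson h (hamH h l) (hamJ h (j + 1)) =
    (l : ℝ) • (h • hamH h (l + j) + hamH h (l + j - 1)) :=
  HasGradient.poisson_eq_of_flat hh (pow_bL_mem_flat hh l) (bN_mem_flat hh j)
    (hasGradient_hamH hh l) (hasGradient_hamJ hh j) (by
      rw [omega_lie_pow_bL_bN hh]
      exact (((hasGradient_hamH hh _).smul h).add (hasGradient_hamH hh _)).smul _)

theorem poisson_hamJ_hamH (l j : ℕ) : poisson h (hamJ h (j + 1)) (hamH h l) =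
    -((l : ℝ) • (h • hamH h (l + j) + hamH h (l + j - 1))) := by
  rw [(hasGradient_hamJ hh j).poisson_antisymm (hasGradient_hamH hh l), poisson_hamH_hamJ hh]

theorem poisson_hamJ_hamJ (i j : ℕ) : poisson h (hamJ h (i + 1)) (hamJ h (j + 1)) =
    ((i : ℝ) - j) • (h • hamJ h (i + j + 1) + hamJ h (i + j)) :=
  HasGradient.poisson_eq_of_flat hh (bN_mem_flat hh i) (bN_mem_flat hh j)
    (hasGradient_hamJ hh i) (hasGradient_hamJ hh j) (by
      rw [omega_lie_bN_bN hh]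
      -- For `i = j = 0` the exponent `i + j - 1` is truncated, but the factor `i - j` vanishes.
      rcases Nat.eq_zero_or_pos (i + j) with hij | hij
      · obtain ⟨rfl, rfl⟩ := Nat.add_eq_zero_iff.1 hij
        simpa using HasGradient.zero h
      · refine (((hasGradient_hamJ hh _).smul h).add ?_).smul _
        have := hasGradient_hamJ hh (i + j - 1)
        rwa [Nat.sub_add_cancel hij] at this)

/-! ### The conserved quantities -/

omit hh in
theorem consI_succ (h : ℝ) (s r : ℕ) (t : ℝ) : consI h (s + 1) (r + 1) t =
    (((s : ℝ) + 1) * t) • (h • hamH h (s + r + 1) + hamH h (s + r)) + hamJ h (r + 1) := by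
  rw [consI, if_neg r.succ_ne_zero, show s + 1 + (r + 1) - 1 = s + r + 1 by omega,
    show s + 1 + (r + 1) - 2 = s + r by omega, Nat.cast_add_one]

theorem hasGradient_hamH_add (m : ℕ) : HasGradient h (h • hamH h (m + 1) + hamH h m)
    (h • omega (bL h ^ (m + 1)) + omega (bL h ^ m)) :=
  ((hasGradient_hamH hh _).smul h).add (hasGradient_hamH hh m)

theorem hasGradient_consI (s r : ℕ) (t : ℝ) : ∃ f, HasGradient h (consI h (s + 1) (r + 1) t) f := by
  rw [consI_succ]
  exact ⟨_, ((hasGradient_hamH_add hh (s + r)).smul _).add (hasGradient_hamJ hh r)⟩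

theorem poisson_hamH_hamH_add (l m : ℕ) :
    poisson h (hamH h l) (h • hamH h (m + 1) + hamH h m) = 0 := by
  have H := hasGradient_hamH hh
  rw [((H (m + 1)).smul h).poisson_add_right (H m) (H l), (H (m + 1)).poisson_smul_right h (H l),
    poisson_hamH_hamH hh, poisson_hamH_hamH hh, smul_zero, add_zero]

theorem poisson_hamH_add_hamJ (m j : ℕ) :
    poisson h (h • hamH h (m + 1) + hamH h m) (hamJ h (j + 1)) =
      (h * ((m : ℝ) + 1)) • (h • hamH h (m + j + 1) + hamH h (m + j)) +
        (m : ℝ) • (h • hamH h (m + j) + hamH h (m + j - 1)) := by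
  have H := hasGradient_hamH hh
  rw [((H (m + 1)).smul h).poisson_add_left (H m) (hasGradient_hamJ hh j),
    (H (m + 1)).poisson_smul_left h (hasGradient_hamJ hh j),
    poisson_hamH_hamJ hh, poisson_hamH_hamJ hh, smul_smul, Nat.cast_add_one,
    show m + 1 + j = m + j + 1 by omega, Nat.add_sub_cancel]

theorem poisson_hamH_consI (s l r : ℕ) (t : ℝ) :
    poisson h (hamH h l) (consI h (s + 1) (r + 1) t) =
      (l : ℝ) • (h • hamH h (l + r) + hamH h (l + r - 1)) := by
  have H := hasGradient_hamH_add hh (s + r)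
  rw [consI_succ, (H.smul _).poisson_add_right (hasGradient_hamJ hh r) (hasGradient_hamH hh l),
    H.poisson_smul_right _ (hasGradient_hamH hh l), poisson_hamH_hamH_add hh, smul_zero, zero_add,
    poisson_hamH_hamJ hh]

/-- With `A_m = h H_(m+1) + H_m`, the part linear in `t` is `{A_(s+i), J_(j+1)} - {A_(s+j),
J_(i+1)}`, whose coefficients differ only by `i - j`; the quadratic part vanishes since the `H` are
in involution. -/
theorem poisson_consI_consI (s i j : ℕ) (t : ℝ) :
    poisson h (consI h (s + 1) (i + 1) t) (consI h (s + 1) (j + 1) t) =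
      ((i : ℝ) - j) • (h • consI h (s + 1) (i + j + 1) t + consI h (s + 1) (i + j) t) := by
  have A := fun m => hasGradient_hamH_add hh m
  have J := hasGradient_hamJ hh
  have AA : ∀ m m', poisson h (h • hamH h (m + 1) + hamH h m)
      (h • hamH h (m' + 1) + hamH h m') = 0 := fun m m' => by
    have H := hasGradient_hamH hh
    rw [((H (m + 1)).smul h).poisson_add_left (H m) (A m'),
      (H (m + 1)).poisson_smul_left h (A m'), poisson_hamH_hamH_add hh, poisson_hamH_hamH_add hh,
      smul_zero, add_zero]
  have JA : ∀ m j, poisson h (hamJ h (j + 1)) (h • hamH h (m + 1) + hamH h m) = _ :=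
    fun m j => (J j).poisson_antisymm (A m)
  set c := ((s : ℝ) + 1) * t with hc
  have e : poisson h (consI h (s + 1) (i + 1) t) (consI h (s + 1) (j + 1) t) =
      c • poisson h (h • hamH h (s + i + 1) + hamH h (s + i)) (hamJ h (j + 1)) -
      c • poisson h (h • hamH h (s + j + 1) + hamH h (s + j)) (hamJ h (i + 1)) +
      poisson h (hamJ h (i + 1)) (hamJ h (j + 1)) := by
    rw [consI_succ, consI_succ, ← hc,
      ((A (s + i)).smul c).poisson_add_left (J i) (((A (s + j)).smul c).add (J j)),
      ((A (s + j)).smul c).poisson_add_right (J j) ((A (s + i)).smul c),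
      ((A (s + j)).smul c).poisson_add_right (J j) (J i),
      (A (s + i)).poisson_smul_left c ((A (s + j)).smul c),
      (A (s + j)).poisson_smul_right c (A (s + i)), AA,
      (A (s + i)).poisson_smul_left c (J j), (A (s + j)).poisson_smul_right c (J i), JA]
    module
  rw [e, poisson_hamH_add_hamJ hh, poisson_hamH_add_hamJ hh, poisson_hamJ_hamJ hh, consI_succ,
    ← hc, show s + j + i = s + i + j by omega, show s + (i + j) = s + i + j by omega]
  -- The value at index zero is zero by convention and does not follow the general formula; it
  -- occurs only with coefficient `i - j = 0`.
  rcases Nat.eq_zero_or_pos (i + j) with hij | hij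
  · obtain ⟨rfl, rfl⟩ := Nat.add_eq_zero_iff.1 hij
    simp
  · obtain ⟨k, hk⟩ := Nat.exists_eq_add_of_le' hij
    have e2 : consI h (s + 1) (i + j) t =
        c • (h • hamH h (s + i + j) + hamH h (s + i + j - 1)) + hamJ h (i + j) := by
      rw [hk, consI_succ, show s + i + j = s + k + 1 by omega, Nat.add_sub_cancel]
    rw [e2]
    push_cast
    module

theorem gatV_flowK {I : V} {f : F} (hI : HasGradient h I f) (s : ℕ) :
    gatV (flowK h s) I = poisson h I (hamH h s) := by
  rw [hI.poisson_eq_gatV (hasGradient_hamH hh s), flowK_eq hh]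

theorem isConserved_hamH (s l : ℕ) : IsConserved (flowK h s) (fun _ => hamH h l) := fun t =>
  ⟨0, fun φ => by rw [map_zero]; exact hasDerivAt_const t _, by
    rw [gatV_flowK hh (hasGradient_hamH hh l), poisson_hamH_hamH hh, add_zero]⟩

/-- The explicit time derivative is exactly `{H_s, J_r}`, which compensates the change of `J_r`
along the flow; the part in `H` commutes with `H_s`. -/
theorem isConserved_consI (s r : ℕ) :
    IsConserved (flowK h (s + 1)) (consI h (s + 1) (r + 1)) := fun t => by
  refine ⟨((s : ℝ) + 1) • (h • hamH h (s + r + 1) + hamH h (s + r)), fun φ => ?_, ?_⟩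
  · have e : (fun t => φ (consI h (s + 1) (r + 1) t)) = fun t =>
        (((s : ℝ) + 1) * t) * φ (h • hamH h (s + r + 1) + hamH h (s + r)) +
          φ (hamJ h (r + 1)) := by
      funext t
      rw [consI_succ, map_add, map_smul, smul_eq_mul]
    rw [e, map_smul, smul_eq_mul]
    have d := (((hasDerivAt_id t).const_mul ((s : ℝ) + 1)).mul_const
      (φ (h • hamH h (s + r + 1) + hamH h (s + r)))).add_const (φ (hamJ h (r + 1)))
    simpa using d
  · obtain ⟨f, hf⟩ := hasGradient_consI hh s r t
    rw [gatV_flowK hh hf, hf.poisson_antisymm (hasGradient_hamH hh (s + 1)),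
      poisson_hamH_consI hh, Nat.cast_add_one, show s + 1 + r = s + r + 1 by omega,
      Nat.add_sub_cancel, add_neg_cancel]

theorem isLieAlg_hamH_hamJ : IsLieAlg (poisson h)
    (Submodule.span ℝ {v | ∃ m : ℕ, 1 ≤ m ∧ (v = hamH h m ∨ v = hamJ h m)}) := by
  set S := {v | ∃ m : ℕ, 1 ≤ m ∧ (v = hamH h m ∨ v = hamJ h m)}
  have hH : ∀ m, hamH h m ∈ Submodule.span ℝ S := fun m => by
    rcases m with _ | m
    · exact zero_mem _
    · exact Submodule.subset_span ⟨m + 1, by omega, Or.inl rfl⟩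
  have hJ : ∀ m, hamJ h m ∈ Submodule.span ℝ S := fun m => by
    rcases m with _ | m
    · exact zero_mem _
    · exact Submodule.subset_span ⟨m + 1, by omega, Or.inr rfl⟩
  refine (isLieAlg_gradV hh).span ?_ ?_
  · rintro v ⟨m, hm, hv⟩
    obtain ⟨m, rfl⟩ := Nat.exists_eq_add_of_le' hm
    rcases hv with rfl | rfl
    · exact ⟨_, hasGradient_hamH hh _⟩
    · exact ⟨_, hasGradient_hamJ hh _⟩
  · rintro v ⟨l, hl, hv⟩ w ⟨r, hr, hw⟩
    obtain ⟨l, rfl⟩ := Nat.exists_eq_add_of_le' hl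
    obtain ⟨r, rfl⟩ := Nat.exists_eq_add_of_le' hr
    rcases hv with rfl | rfl <;> rcases hw with rfl | rfl
    · rw [poisson_hamH_hamH hh]
      exact zero_mem _
    · rw [poisson_hamH_hamJ hh]
      exact Submodule.smul_mem _ _ (add_mem (Submodule.smul_mem _ _ (hH _)) (hH _))
    · rw [poisson_hamJ_hamH hh]
      exact neg_mem (Submodule.smul_mem _ _ (add_mem (Submodule.smul_mem _ _ (hH _)) (hH _)))
    · rw [poisson_hamJ_hamJ hh]
      exact Submodule.smul_mem _ _ (add_mem (Submodule.smul_mem _ _ (hJ _)) (hJ _))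

theorem isLieAlg_hamH_consI (s : ℕ) : IsLieAlg (fun a b : ℝ → V => fun t => poisson h (a t) (b t))
    (Submodule.span ℝ
      {v | ∃ m : ℕ, 1 ≤ m ∧ (v = (fun _ => hamH h m) ∨ v = consI h (s + 1) m)}) := by
  set S := {v : ℝ → V | ∃ m : ℕ, 1 ≤ m ∧ (v = (fun _ => hamH h m) ∨ v = consI h (s + 1) m)}
  have hH : ∀ m, (fun _ : ℝ => hamH h m) ∈ Submodule.span ℝ S := fun m => by
    rcases m with _ | m
    · exact zero_mem _
    · exact Submodule.subset_span ⟨m + 1, by omega, Or.inl rfl⟩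
  have hI : ∀ m, consI h (s + 1) m ∈ Submodule.span ℝ S := fun m => by
    rcases m with _ | m
    · exact zero_mem _
    · exact Submodule.subset_span ⟨m + 1, by omega, Or.inr rfl⟩
  -- The bracket is pointwise in `t`, so the Lie algebra laws hold for all families of functionals
  -- with gradients; only closure on generators is left.
  refine (isLieAlg_gradV hh).pi.span ?_ ?_
  · rintro v ⟨m, hm, hv⟩ t -
    obtain ⟨m, rfl⟩ := Nat.exists_eq_add_of_le' hm
    rcases hv with rfl | rfl
    · exact ⟨_, hasGradient_hamH hh _⟩
    · exact hasGradient_consI hh s m t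
  · rintro v ⟨l, hl, hv⟩ w ⟨r, hr, hw⟩
    obtain ⟨l, rfl⟩ := Nat.exists_eq_add_of_le' hl
    obtain ⟨r, rfl⟩ := Nat.exists_eq_add_of_le' hr
    have hHI : ∀ l r, (fun t => poisson h (hamH h l) (consI h (s + 1) (r + 1) t)) ∈
        Submodule.span ℝ S := fun l r => by
      simp only [poisson_hamH_consI hh]
      exact Submodule.smul_mem _ _ (add_mem (Submodule.smul_mem _ _ (hH _)) (hH _))
    rcases hv with rfl | rfl <;> rcases hw with rfl | rfl
    · simp only [poisson_hamH_hamH hh]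
      exact zero_mem _
    · exact hHI _ _
    · have e : (fun t => poisson h (consI h (s + 1) (l + 1) t) (hamH h (r + 1))) =
          -fun t => poisson h (hamH h (r + 1)) (consI h (s + 1) (l + 1) t) := funext fun t => by
        obtain ⟨f, hf⟩ := hasGradient_consI hh s l t
        exact hf.poisson_antisymm (hasGradient_hamH hh (r + 1))
      rw [e]
      exact neg_mem (hHI _ _)
    · simp only [poisson_consI_consI hh]
      exact Submodule.smul_mem _ _ (add_mem (Submodule.smul_mem _ _ (hI _)) (hI _))

end Hamiltonians

end

end DDKP

/-! ### Assembly, with the indices shifted to start at one -/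

open DDKP in
theorem mainTheorem6 (h : ℝ) (hh : h ≠ 0) :
    -- the flows are well defined
    (∀ m : ℕ, 1 ≤ m → zcA h m = Op.const (Unitization.inr (flowK h m)) ∧
      ∃! q : Op × F, IsNonisospectral h m q.1 q.2) ∧
    -- the functionals have the gradients `∂⁻¹ K_l` and `∂⁻¹ σ_r`
    (∀ m : ℕ, 1 ≤ m → HasGradient h (hamH h m) (gam h m) ∧ HasGradient h (hamJ h m) (omg h m)) ∧
    -- the conserved quantities of the isospectral equations
    (∀ s : ℕ, 1 ≤ s →
      (∀ l : ℕ, 1 ≤ l → IsConserved (flowK h s) (fun _ => hamH h l)) ∧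
      (∀ r : ℕ, 1 ≤ r → IsConserved (flowK h s) (consI h s r))) ∧
    -- the brackets of the Hamiltonians
    (∀ l r : ℕ, 1 ≤ l → 1 ≤ r →
      poisson h (hamH h l) (hamH h r) = 0 ∧
      poisson h (hamH h l) (hamJ h r) =
        (l : ℝ) • (h • hamH h (l + r - 1) + hamH h (l + r - 2)) ∧
      poisson h (hamJ h l) (hamJ h r) =
        ((l : ℝ) - r) • (h • hamJ h (l + r - 1) + hamJ h (l + r - 2))) ∧
    -- the brackets of the conserved quantities
    (∀ s l r : ℕ, 1 ≤ s → 1 ≤ l → 1 ≤ r → ∀ t : ℝ,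
      poisson h (hamH h l) (consI h s r t) =
        (l : ℝ) • (h • hamH h (l + r - 1) + hamH h (l + r - 2)) ∧
      poisson h (consI h s l t) (consI h s r t) =
        ((l : ℝ) - r) • (h • consI h s (l + r - 1) t + consI h s (l + r - 2) t)) ∧
    -- the Lie algebras they span
    IsLieAlg (poisson h)
      (Submodule.span ℝ {v | ∃ m : ℕ, 1 ≤ m ∧ (v = hamH h m ∨ v = hamJ h m)}) ∧
    (∀ s : ℕ, 1 ≤ s →
      IsLieAlg (fun a b : ℝ → V => fun t => poisson h (a t) (b t))
        (Submodule.span ℝ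
          {v | ∃ m : ℕ, 1 ≤ m ∧ (v = (fun _ => hamH h m) ∨ v = consI h s m)})) := by
  refine ⟨fun m hm => ⟨zcA_eq hh m, existsUnique_isNonisospectral hh m hm⟩, fun m hm => ?_,
    fun s hs => ⟨fun l _ => isConserved_hamH hh s l, fun r hr => ?_⟩, fun l r hl hr => ?_,
    fun s l r hs hl hr t => ?_, isLieAlg_hamH_hamJ hh, fun s hs => ?_⟩
  · obtain ⟨m, rfl⟩ := Nat.exists_eq_add_of_le' hm
    rw [gam_eq hh, omg_eq hh]
    exact ⟨hasGradient_hamH hh _, hasGradient_hamJ hh _⟩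
  · obtain ⟨s, rfl⟩ := Nat.exists_eq_add_of_le' hs
    obtain ⟨r, rfl⟩ := Nat.exists_eq_add_of_le' hr
    exact isConserved_consI hh s r
  · obtain ⟨l, rfl⟩ := Nat.exists_eq_add_of_le' hl
    obtain ⟨r, rfl⟩ := Nat.exists_eq_add_of_le' hr
    have e1 : l + 1 + (r + 1) - 1 = l + 1 + r := by omega
    have e2 : l + 1 + (r + 1) - 2 = l + 1 + r - 1 := by omega
    refine ⟨poisson_hamH_hamH hh _ _, ?_, ?_⟩
    · rw [poisson_hamH_hamJ hh, e1, e2]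
    · rw [poisson_hamJ_hamJ hh, e1, e2, Nat.cast_add_one, Nat.cast_add_one,
        add_sub_add_right_eq_sub, show l + 1 + r = l + r + 1 by omega, Nat.add_sub_cancel]
  · obtain ⟨s, rfl⟩ := Nat.exists_eq_add_of_le' hs
    obtain ⟨l, rfl⟩ := Nat.exists_eq_add_of_le' hl
    obtain ⟨r, rfl⟩ := Nat.exists_eq_add_of_le' hr
    have e1 : l + 1 + (r + 1) - 1 = l + 1 + r := by omega
    have e2 : l + 1 + (r + 1) - 2 = l + 1 + r - 1 := by omega
    constructor
    · rw [poisson_hamH_consI hh, e1, e2]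
    · rw [poisson_consI_consI hh, e1, e2, Nat.cast_add_one, Nat.cast_add_one,
        add_sub_add_right_eq_sub, show l + 1 + r = l + r + 1 by omega, Nat.add_sub_cancel]
  · obtain ⟨s, rfl⟩ := Nat.exists_eq_add_of_le' hs
    exact isLieAlg_hamH_consI hh s
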